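/- For an integer $s\ge 0$ and $\gamma\in\mathbb R$ let $H^s_\gamma(\mathbb R^2)$ be the completion of $C_0^\infty(\mathbb R^2,\mathbb C)$ with respect to the norm $$\|u\|_{H^s_\gamma}=\sum_{|\alpha|\le s}\big\|\langle x\rangle^{\gamma}D^\alpha u\big\|_{L^2(\mathbb R^2)},\qquad \langle x\rangle=(1+|x|^2)^{1/2}.$$ For $n\in\mathbb N\cup\{0\}$ let $h^s_{n,\gamma}\subset H^s_\gamma(\mathbb R^2)$ be the subspace of those $u$ that have, in polar coordinates, the form $u(r,\theta)=u_n(r)e^{in\theta}$ almost everywhere; $u_n$ is called the radial profile of $u$. For $n=0$ this is the subspace $H^s_{r,\gamma}(\mathbb R^2)$ of radially symmetric functions. Let $s\ge 2$ be an integer and $\gamma\in\mathbb R$. (a) The operator $\Delta-\mathrm{Id}\colon H^s_\gamma(\mathbb R^2)\to H^{s-2}_\gamma(\mathbb R^2)$ (with $\Delta$ taken in the sense of distributions) is well defined, bounded and invertible with bounded inverse. (b) For every $n\in\mathbb N\cup\{0\}$ the operator $\Delta_n-\mathrm{Id}$, with $\Delta_n=\partial_{rr}+\frac1r\partial_r-\frac{n^2}{r^2}$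 taken in the sense of distributions on $(0,\infty)$ and acting on radial profiles, $u_n(r)e^{in\theta}\mapsto\big((\Delta_n-\mathrm{Id})u_n\big)(r)\,e^{in\theta}$, is well defined and bounded from $h^s_{n,\gamma}$ to $h^{s-2}_{n,\gamma}$, and invertible with bounded inverse. In particular $\Delta_0-\mathrm{Id}\colon H^s_{r,\gamma}(\mathbb R^2)\to H^{s-2}_{r,\gamma}(\mathbb R^2)$ is invertible. -/

import Mathlib

open MeasureTheory Set
open scoped ContDiff Laplacian

noncomputable section

namespace WeightedSobolev

/-- The Euclidean plane. -/
abbrev Plane : Type := EuclideanSpace ℝ (Fin 2)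

/-- Complex-valued smooth functions with compact support on a real normed space. -/
def IsTest {E : Type*} [NormedAddCommGroup E] [NormedSpace ℝ E] (φ : E → ℂ) : Prop :=
  ContDiff ℝ ∞ φ ∧ HasCompactSupport φ

/-- The bracket `⟨x⟩ = (1 + |x|²)^{1/2}`. -/
def bracket (x : Plane) : ℝ := Real.sqrt (1 + ‖x‖ ^ 2)

/-- The partial derivative `∂φ/∂xᵢ`. -/
def pderiv (i : Fin 2) (φ : Plane → ℂ) : Plane → ℂ :=
  fun x => fderiv ℝ φ x (EuclideanSpace.single i 1)

/-- `D^α φ = ∂₁^{α₁} ∂₂^{α₂} φ`. -/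
def multiDeriv (α : ℕ × ℕ) (φ : Plane → ℂ) : Plane → ℂ :=
  (pderiv 0)^[α.1] ((pderiv 1)^[α.2] φ)

/-- The multi-indices `α` with `|α| ≤ s`. -/
abbrev MultiIndex (s : ℕ) : Type := {α : ℕ × ℕ // α.1 + α.2 ≤ s}

instance (s : ℕ) : Fintype (MultiIndex s) :=
  Fintype.ofInjective
    (fun α : MultiIndex s =>
      ((⟨α.1.1, by have := α.2; omega⟩, ⟨α.1.2, by have := α.2; omega⟩) :
        Fin (s + 1) × Fin (s + 1)))
    (by
      rintro ⟨⟨a, b⟩, h⟩ ⟨⟨c, d⟩, h'⟩ H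
      simpa using H)

/-- Families `(v_α)_{|α| ≤ s}` in `L²(ℝ²; ℂ)`, with norm `∑_{|α| ≤ s} ‖v_α‖_{L²}`. -/
abbrev JetSpace (s : ℕ) : Type :=
  PiLp 1 (fun _ : MultiIndex s => Lp ℂ 2 (volume : Measure Plane))

theorem IsTest.pderiv {φ : Plane → ℂ} (h : IsTest φ) (i : Fin 2) : IsTest (pderiv i φ) := by
  refine ⟨?_, ?_⟩
  · have h1 : ContDiff ℝ ∞ (fderiv ℝ φ) := h.1.fderiv_right (by simp)
    exact h1.clm_apply contDiff_const
  · have h1 := h.2.fderiv (𝕜 := ℝ)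
    exact h1.comp_left (g := fun L : Plane →L[ℝ] ℂ => L (EuclideanSpace.single i 1)) (by simp)

theorem IsTest.iterate_pderiv {φ : Plane → ℂ} (h : IsTest φ) (i : Fin 2) (k : ℕ) :
    IsTest ((WeightedSobolev.pderiv i)^[k] φ) := by
  induction k with
  | zero => exact h
  | succ k ih => rw [Function.iterate_succ_apply']; exact ih.pderiv i

theorem IsTest.add {φ ψ : Plane → ℂ} (h : IsTest φ) (h' : IsTest ψ) : IsTest (φ + ψ) :=
  ⟨h.1.add h'.1, h.2.add h'.2⟩

theorem IsTest.smul {φ : Plane → ℂ} (h : IsTest φ) (c : ℂ) : IsTest (c • φ) :=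
  ⟨contDiff_const.smul h.1, h.2.smul_left (f := fun _ => c)⟩

theorem pderiv_add {φ ψ : Plane → ℂ} (h : IsTest φ) (h' : IsTest ψ) (i : Fin 2) :
    pderiv i (φ + ψ) = pderiv i φ + pderiv i ψ := by
  funext x
  have h1 : DifferentiableAt ℝ φ x := h.1.differentiable (by simp) x
  have h2 : DifferentiableAt ℝ ψ x := h'.1.differentiable (by simp) x
  simp [pderiv, fderiv_add h1 h2]

theorem pderiv_smul {φ : Plane → ℂ} (h : IsTest φ) (c : ℂ) (i : Fin 2) :
    pderiv i (c • φ) = c • pderiv i φ := by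
  funext x
  have h1 : DifferentiableAt ℝ φ x := h.1.differentiable (by simp) x
  simp [pderiv, fderiv_const_smul h1 c]

theorem iterate_pderiv_add {φ ψ : Plane → ℂ} (h : IsTest φ) (h' : IsTest ψ) (i : Fin 2) (k : ℕ) :
    (pderiv i)^[k] (φ + ψ) = (pderiv i)^[k] φ + (pderiv i)^[k] ψ := by
  induction k with
  | zero => rfl
  | succ k ih =>
    rw [Function.iterate_succ_apply', ih,
      pderiv_add (h.iterate_pderiv i k) (h'.iterate_pderiv i k),
      Function.iterate_succ_apply', Function.iterate_succ_apply']

theorem iterate_pderiv_smul {φ : Plane → ℂ} (h : IsTest φ) (c : ℂ) (i : Fin 2) (k : ℕ) :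
    (pderiv i)^[k] (c • φ) = c • (pderiv i)^[k] φ := by
  induction k with
  | zero => rfl
  | succ k ih =>
    rw [Function.iterate_succ_apply', ih, pderiv_smul (h.iterate_pderiv i k),
      Function.iterate_succ_apply']

theorem multiDeriv_add {φ ψ : Plane → ℂ} (h : IsTest φ) (h' : IsTest ψ) (α : ℕ × ℕ) :
    multiDeriv α (φ + ψ) = multiDeriv α φ + multiDeriv α ψ := by
  rw [multiDeriv, iterate_pderiv_add h h',
    iterate_pderiv_add (h.iterate_pderiv 1 _) (h'.iterate_pderiv 1 _)]
  rfl

theorem multiDeriv_smul {φ : Plane → ℂ} (h : IsTest φ) (c : ℂ) (α : ℕ × ℕ) :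
    multiDeriv α (c • φ) = c • multiDeriv α φ := by
  rw [multiDeriv, iterate_pderiv_smul h, iterate_pderiv_smul (h.iterate_pderiv 1 _)]
  rfl

/-- The weighted jet of `φ`: the family `(⟨x⟩^γ D^α φ)_{|α| ≤ s}`. Its norm in `JetSpace s` is
`∑_{|α| ≤ s} ‖⟨x⟩^γ D^α φ‖_{L²}`. -/
def IsWeightedJet (s : ℕ) (γ : ℝ) (φ : Plane → ℂ) (v : JetSpace s) : Prop :=
  ∀ α : MultiIndex s, v α =ᵐ[volume] fun x => ((bracket x ^ γ : ℝ) : ℂ) * multiDeriv α.1 φ x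

/-- The space `C₀^∞(ℝ²; ℂ)` with the norm `∑_{|α| ≤ s} ‖⟨x⟩^γ D^α φ‖_{L²}`, realised by its
weighted jets. -/
def testJets (s : ℕ) (γ : ℝ) : Submodule ℂ (JetSpace s) where
  carrier := {v | ∃ φ : Plane → ℂ, IsTest φ ∧ IsWeightedJet s γ φ v}
  zero_mem' := by
    refine ⟨0, ⟨contDiff_const, HasCompactSupport.zero⟩, fun α => ?_⟩
    have h0 : multiDeriv α.1 (0 : Plane → ℂ) = 0 := by
      have h := multiDeriv_smul (φ := 0) ⟨contDiff_const, HasCompactSupport.zero⟩ 0 α.1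
      simpa using h
    filter_upwards [Lp.coeFn_zero ℂ 2 (volume : Measure Plane)] with x hx
    simp [h0]
  add_mem' := by
    rintro v w ⟨φ, hφ, hv⟩ ⟨ψ, hψ, hw⟩
    refine ⟨φ + ψ, hφ.add hψ, fun α => ?_⟩
    filter_upwards [hv α, hw α, Lp.coeFn_add (v α) (w α)] with x h1 h2 h3
    rw [PiLp.add_apply, h3, Pi.add_apply, h1, h2, multiDeriv_add hφ hψ, Pi.add_apply, mul_add]
  smul_mem' := by
    rintro c v ⟨φ, hφ, hv⟩
    refine ⟨c • φ, hφ.smul c, fun α => ?_⟩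
    filter_upwards [hv α, Lp.coeFn_smul c (v α)] with x h1 h3
    rw [PiLp.smul_apply, h3, Pi.smul_apply, h1, multiDeriv_smul hφ, Pi.smul_apply]
    simp only [smul_eq_mul]
    ring

/-- The weighted Sobolev space `H^s_γ(ℝ²)`: the completion of `C₀^∞(ℝ²; ℂ)` for the norm
`∑_{|α| ≤ s} ‖⟨x⟩^γ D^α φ‖_{L²}`, that is, the closure of the weighted jets in the complete
space `JetSpace s`. -/
def Sobolev (s : ℕ) (γ : ℝ) : Submodule ℂ (JetSpace s) :=
  (testJets s γ).topologicalClosure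

/-- The function on the plane represented by an element of `H^s_γ(ℝ²)`: its component of index
`α = 0` divided by the weight. -/
def toFun {s : ℕ} {γ : ℝ} (u : Sobolev s γ) : Plane → ℂ :=
  fun x => ((bracket x ^ (-γ) : ℝ) : ℂ) * (u : JetSpace s) ⟨(0, 0), Nat.zero_le s⟩ x

/-- `Δu - u = f` on the plane in the sense of distributions. -/
def LaplacianSubId (u f : Plane → ℂ) : Prop :=
  ∀ φ : Plane → ℂ, IsTest φ → ∫ x, f x * φ x = ∫ x, u x * ((Δ φ) x - φ x)

/-- `e^{inθ}`, where `θ` is the polar angle of `x`. -/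
def angular (n : ℕ) (x : Plane) : ℂ :=
  Complex.exp (n * (Complex.arg ⟨x 0, x 1⟩ : ℂ) * Complex.I)

/-- `u(r, θ) = p(r) e^{inθ}` almost everywhere. -/
def IsProfile {s : ℕ} {γ : ℝ} (n : ℕ) (p : ℝ → ℂ) (u : Sobolev s γ) : Prop :=
  toFun u =ᵐ[volume] fun x => p ‖x‖ * angular n x

/-- The subspace of those elements of `H^s_γ(ℝ²)` that have the form `p(r) e^{inθ}`. For `n = 0`
it is the subspace of radially symmetric functions. -/
def modeSpace (n s : ℕ) (γ : ℝ) : Submodule ℂ (Sobolev s γ) where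
  carrier := {u | ∃ p : ℝ → ℂ, IsProfile n p u}
  zero_mem' := by
    refine ⟨0, ?_⟩
    unfold IsProfile
    filter_upwards [Lp.coeFn_zero ℂ 2 (volume : Measure Plane)] with x hx
    simp [toFun]
  add_mem' := by
    rintro u v ⟨p, hp⟩ ⟨q, hq⟩
    refine ⟨p + q, ?_⟩
    unfold IsProfile at *
    filter_upwards [hp, hq, Lp.coeFn_add ((u : JetSpace s) ⟨(0, 0), Nat.zero_le s⟩)
      ((v : JetSpace s) ⟨(0, 0), Nat.zero_le s⟩)] with x h1 h2 h3
    have h4 : toFun (u + v) x = toFun u x + toFun v x := by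
      simp only [toFun, Submodule.coe_add, PiLp.add_apply]
      rw [h3, Pi.add_apply, mul_add]
    rw [h4, h1, h2, Pi.add_apply, add_mul]
  smul_mem' := by
    rintro c u ⟨p, hp⟩
    refine ⟨c • p, ?_⟩
    unfold IsProfile at *
    filter_upwards [hp, Lp.coeFn_smul c ((u : JetSpace s) ⟨(0, 0), Nat.zero_le s⟩)] with x h1 h3
    have h4 : toFun (c • u) x = c * toFun u x := by
      simp only [toFun, Submodule.coe_smul, PiLp.smul_apply]
      rw [h3, Pi.smul_apply, smul_eq_mul]
      ring
    rw [h4, h1, Pi.smul_apply, smul_eq_mul, mul_assoc]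

/-- `Δₙ p - p = q` with `Δₙ = ∂_rr + r⁻¹ ∂_r - n² r⁻²`, in the sense of distributions on `(0, ∞)`
(the operator `Δₙ` is formally self-adjoint for `r dr`). -/
def RadialLaplacianSubId (n : ℕ) (p q : ℝ → ℂ) : Prop :=
  ∀ ψ : ℝ → ℂ, IsTest ψ → tsupport ψ ⊆ Ioi 0 →
    ∫ r in Ioi (0 : ℝ), q r * ψ r * r =
      ∫ r in Ioi (0 : ℝ),
        p r * (deriv (deriv ψ) r + deriv ψ r / r - n ^ 2 / r ^ 2 * ψ r - ψ r) * r

end WeightedSobolev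

end

/-!
On Schwartz functions `Δ - 1` is bijective, being a Fourier multiplier whose symbol and its inverse
grow at most polynomially, and integration by parts gives `‖∂ᵢ∂ⱼf‖, ‖∂ᵢf‖, ‖f‖ ≤ C ‖Δf - f‖` in
`L²`. For the weight `w = (R² + |x|²)^{γ/2}`, which is comparable to `⟨x⟩^γ`, the commutators
`[∂ᵢ, w]` and `[∂ᵢ∂ⱼ, w]` are small relative to `w` when `R` is large, so the estimate applied to
`w f` absorbs them and persists in the weighted space. As `Δ - 1` commutes with derivatives it is
bounded above and below for the norms of `H^{s+2}_γ` and `H^s_γ`, hence extends from the dense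
subspace of Schwartz functions to an isomorphism, which by duality is the distributional operator.

The functions of the form `p(r) e^{inθ}` are those on which the rotation by `a` acts as
multiplication by `aⁿ`. This condition can be tested against Schwartz functions, and since `Δ - 1`
commutes with rotations and is onto on Schwartz functions, `u` satisfies it if and only if
`Δu - u` does. The radial equation is the equation on the plane tested against `ψ(r) e^{-inθ}`.
-/

noncomputable section

namespace WeightedSobolev

open SchwartzMap LineDeriv Filter Topology
open scoped SchwartzMap

/-! ### The operator `Δ - 1` on Schwartz functions and its unweighted `H²` estimate -/

section Helmholtz

section TemperateGrowth

variable {V W : Type*} [NormedAddCommGroup V] [NormedSpace ℝ V] [NormedAddCommGroup W]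
  [NormedSpace ℝ W] {g : V → W}

theorem hasTemperateGrowth_fderiv (hg : g.HasTemperateGrowth) :
    (fderiv ℝ g).HasTemperateGrowth := by
  refine ⟨hg.1.fderiv_right (by simp), fun n => ?_⟩
  simpa only [norm_iteratedFDeriv_fderiv] using hg.2 (n + 1)

theorem hasTemperateGrowth_fderiv_apply (hg : g.HasTemperateGrowth) (v : V) :
    (fun x => fderiv ℝ g x v).HasTemperateGrowth :=
  (ContinuousLinearMap.apply ℝ W v).hasTemperateGrowth.comp (hasTemperateGrowth_fderiv hg)

end TemperateGrowth

variable {E F ι : Type*} [NormedAddCommGroup E] [InnerProductSpace ℝ E]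
  [NormedAddCommGroup F] [InnerProductSpace ℂ F]

theorem lineDerivOp_comm (u v : E) (f : 𝓢(E, F)) : ∂_{u} (∂_{v} f) = ∂_{v} (∂_{u} f) := by
  have hsnd : ∀ w w' x, (∂_{w} (∂_{w'} f) : 𝓢(E, F)) x = fderiv ℝ (fderiv ℝ f) x w w' := by
    intro w w' x
    have hd : DifferentiableAt ℝ (fderiv ℝ f) x :=
      ((f.smooth 2).fderiv_right (m := 1) (by norm_num)).differentiable (by simp) x
    change fderiv ℝ (fun y => fderiv ℝ f y w') x w = _
    rw [fderiv_clm_apply hd (differentiableAt_const _)]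
    simp
  ext x
  rw [hsnd, hsnd]
  exact ((f.contDiffAt 2).isSymmSndFDerivAt minSmoothness_of_isRCLikeNormedField.le).eq u v

/-- Multiplication of Schwartz functions by a real function of temperate growth (the zero map for
other functions). -/
def schwartzMul (g : E → ℝ) : 𝓢(E, F) →L[ℂ] 𝓢(E, F) :=
  smulLeftCLM F fun x => (g x : ℂ)

theorem schwartzMul_apply {g : E → ℝ} (hg : g.HasTemperateGrowth) (f : 𝓢(E, F)) (x : E) :
    schwartzMul g f x = g x • f x := by
  have hg' : (fun x => (g x : ℂ)).HasTemperateGrowth :=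
    Function.HasTemperateGrowth.comp Function.Complex.hasTemperateGrowth_ofReal hg
  rw [schwartzMul, smulLeftCLM_apply_apply hg', Complex.coe_smul]

theorem lineDerivOp_schwartzMul {g g' : E → ℝ} (hg : g.HasTemperateGrowth)
    (hg' : g'.HasTemperateGrowth) {v : E} (h : ∀ x, fderiv ℝ g x v = g' x) (f : 𝓢(E, F)) :
    ∂_{v} (schwartzMul g f) = schwartzMul g (∂_{v} f) + schwartzMul g' f := by
  ext x
  have hgf : (schwartzMul g f : E → F) = fun y => g y • f y := funext (schwartzMul_apply hg f)
  have hd : DifferentiableAt ℝ g x := hg.1.differentiable (by simp) x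
  rw [add_apply, schwartzMul_apply hg, schwartzMul_apply hg', lineDerivOp_apply_eq_fderiv,
    lineDerivOp_apply_eq_fderiv, hgf, fderiv_fun_smul hd f.differentiableAt]
  simp [h x]

variable [FiniteDimensional ℝ E]

/-- The operator `Δ - 1` on Schwartz functions. -/
def helmholtz : 𝓢(E, F) →L[ℂ] 𝓢(E, F) :=
  laplacianCLM ℂ E 𝓢(E, F) - ContinuousLinearMap.id ℂ _

theorem helmholtz_apply (f : 𝓢(E, F)) : helmholtz f = Δ f - f := by
  rw [helmholtz, sub_apply, laplacianCLM_eq, ContinuousLinearMap.id_apply]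

theorem helmholtz_eq_sum [Fintype ι] (b : OrthonormalBasis ι ℝ E) (f : 𝓢(E, F)) :
    helmholtz f = ∑ i, ∂_{b i} (∂_{b i} f) - f := by
  rw [helmholtz_apply, laplacian_eq_sum b]

theorem lineDerivOp_helmholtz (v : E) (f : 𝓢(E, F)) :
    ∂_{v} (helmholtz f) = helmholtz (∂_{v} f) := by
  rw [← lineDerivOpCLM_apply (R := ℂ) v]
  simp only [helmholtz_eq_sum (stdOrthonormalBasis ℝ E), map_sub, map_sum, lineDerivOpCLM_apply,
    lineDerivOp_comm v]

variable [MeasurableSpace E] [BorelSpace E]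

/-- The embedding of Schwartz functions into `L²`. -/
abbrev schwartzToL2 : 𝓢(E, F) →L[ℂ] Lp F 2 (volume : Measure E) :=
  toLpCLM ℂ F 2 volume

theorem inner_lineDerivOp_left (v : E) (f g : 𝓢(E, F)) :
    inner ℂ (schwartzToL2 (∂_{v} f)) (schwartzToL2 g) =
      -inner ℂ (schwartzToL2 f) (schwartzToL2 (∂_{v} g)) := by
  simp only [schwartzToL2, toLpCLM_apply, inner_toL2_toL2_eq]
  rw [eq_neg_iff_add_eq_zero, add_comm, ← eq_neg_iff_add_eq_zero]
  exact integral_bilinear_lineDerivOp_right_eq_neg_left f g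
    (isBoundedBilinearMap_inner (𝕜 := ℂ)).toContinuousLinearMap v

theorem inner_lineDerivOp_lineDerivOp (u v : E) (f : 𝓢(E, F)) :
    inner ℂ (schwartzToL2 (∂_{u} (∂_{u} f))) (schwartzToL2 (∂_{v} (∂_{v} f))) =
      ‖schwartzToL2 (∂_{u} (∂_{v} f))‖ ^ 2 := by
  rw [inner_lineDerivOp_left, lineDerivOp_comm u v (∂_{v} f), ← inner_lineDerivOp_left,
    lineDerivOp_comm v u, inner_self_eq_norm_sq_to_K]
  rfl

theorem norm_sq_laplacian [Fintype ι] (b : OrthonormalBasis ι ℝ E) (f : 𝓢(E, F)) :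
    ‖schwartzToL2 (Δ f)‖ ^ 2 = ∑ i, ∑ j, ‖schwartzToL2 (∂_{b i} (∂_{b j} f))‖ ^ 2 := by
  have h : inner ℂ (schwartzToL2 (Δ f)) (schwartzToL2 (Δ f)) = (‖schwartzToL2 (Δ f)‖ : ℂ) ^ 2 :=
    inner_self_eq_norm_sq_to_K _
  simp only [laplacian_eq_sum b, map_sum, sum_inner, inner_sum,
    inner_lineDerivOp_lineDerivOp] at h ⊢
  rw [Finset.sum_comm]
  exact_mod_cast h.symm

theorem inner_laplacian_self [Fintype ι] (b : OrthonormalBasis ι ℝ E) (f : 𝓢(E, F)) :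
    inner ℂ (schwartzToL2 (Δ f)) (schwartzToL2 f) =
      -∑ i, (‖schwartzToL2 (∂_{b i} f)‖ : ℂ) ^ 2 := by
  simp only [laplacian_eq_sum b, map_sum, sum_inner, inner_lineDerivOp_left,
    inner_self_eq_norm_sq_to_K, Finset.sum_neg_distrib]
  rfl

theorem norm_sq_helmholtz [Fintype ι] (b : OrthonormalBasis ι ℝ E) (f : 𝓢(E, F)) :
    ‖schwartzToL2 (helmholtz f)‖ ^ 2 =
      ∑ i, ∑ j, ‖schwartzToL2 (∂_{b i} (∂_{b j} f))‖ ^ 2 +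
        2 * ∑ i, ‖schwartzToL2 (∂_{b i} f)‖ ^ 2 + ‖schwartzToL2 f‖ ^ 2 := by
  have hre : RCLike.re (inner ℂ (schwartzToL2 (Δ f)) (schwartzToL2 f)) =
      -∑ i, ‖schwartzToL2 (∂_{b i} f)‖ ^ 2 := by
    rw [inner_laplacian_self b]
    exact_mod_cast Complex.ofReal_re _
  rw [helmholtz_apply, map_sub, norm_sub_sq (𝕜 := ℂ), hre, norm_sq_laplacian b]
  ring

theorem norm_le_norm_helmholtz (f : 𝓢(E, F)) :
    ‖schwartzToL2 f‖ ≤ ‖schwartzToL2 (helmholtz f)‖ := by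
  refine (sq_le_sq₀ (norm_nonneg _) (norm_nonneg _)).1 ?_
  rw [norm_sq_helmholtz (stdOrthonormalBasis ℝ E)]
  exact le_add_of_nonneg_left (by positivity)

variable [Fintype ι]

theorem norm_lineDerivOp_le (b : OrthonormalBasis ι ℝ E) (i : ι) (f : 𝓢(E, F)) :
    ‖schwartzToL2 (∂_{b i} f)‖ ≤ ‖schwartzToL2 (helmholtz f)‖ := by
  refine (sq_le_sq₀ (norm_nonneg _) (norm_nonneg _)).1 ?_
  rw [norm_sq_helmholtz b]
  calc _ ≤ ∑ k, ‖schwartzToL2 (∂_{b k} f)‖ ^ 2 :=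
        Finset.single_le_sum (f := fun k => ‖schwartzToL2 (∂_{b k} f)‖ ^ 2)
          (fun _ _ => sq_nonneg _) (Finset.mem_univ i)
    _ ≤ 2 * ∑ k, ‖schwartzToL2 (∂_{b k} f)‖ ^ 2 :=
        le_mul_of_one_le_left (by positivity) one_le_two
    _ ≤ _ := (le_add_of_nonneg_left (by positivity)).trans (le_add_of_nonneg_right (by positivity))

theorem norm_lineDerivOp_lineDerivOp_le (b : OrthonormalBasis ι ℝ E) (i j : ι) (f : 𝓢(E, F)) :
    ‖schwartzToL2 (∂_{b i} (∂_{b j} f))‖ ≤ ‖schwartzToL2 (helmholtz f)‖ := by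
  refine (sq_le_sq₀ (norm_nonneg _) (norm_nonneg _)).1 ?_
  rw [norm_sq_helmholtz b, add_assoc]
  calc _ ≤ ∑ l, ‖schwartzToL2 (∂_{b i} (∂_{b l} f))‖ ^ 2 :=
        Finset.single_le_sum (f := fun l => ‖schwartzToL2 (∂_{b i} (∂_{b l} f))‖ ^ 2)
          (fun _ _ => sq_nonneg _) (Finset.mem_univ j)
    _ ≤ ∑ k, ∑ l, ‖schwartzToL2 (∂_{b k} (∂_{b l} f))‖ ^ 2 :=
        Finset.single_le_sum (f := fun k => ∑ l, ‖schwartzToL2 (∂_{b k} (∂_{b l} f))‖ ^ 2)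
          (fun _ _ => by positivity) (Finset.mem_univ i)
    _ ≤ _ := le_add_of_nonneg_right (by positivity)

end Helmholtz

/-! ### Slowly varying weights -/

section SlowlyVarying

variable {E F ι : Type*} [NormedAddCommGroup E] [InnerProductSpace ℝ E] [FiniteDimensional ℝ E]
  [MeasurableSpace E] [BorelSpace E] [NormedAddCommGroup F] [InnerProductSpace ℂ F]

theorem norm_schwartzMul_le {g h : E → ℝ} (hg : g.HasTemperateGrowth)
    (hh : h.HasTemperateGrowth) {c : ℝ} (hgh : ∀ x, |g x| ≤ c * |h x|) (f : 𝓢(E, F)) :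
    ‖schwartzToL2 (schwartzMul g f)‖ ≤ c * ‖schwartzToL2 (schwartzMul h f)‖ := by
  refine Lp.norm_le_mul_norm_of_ae_le_mul ?_
  filter_upwards [coeFn_toLp (schwartzMul g f) 2 volume, coeFn_toLp (schwartzMul h f) 2 volume]
    with x hgf hhf
  rw [toLpCLM_apply, toLpCLM_apply, hgf, hhf, schwartzMul_apply hg, schwartzMul_apply hh,
    norm_smul, norm_smul, ← mul_assoc]
  exact mul_le_mul_of_nonneg_right (hgh x) (norm_nonneg _)

/-- A weight of temperate growth whose first and second derivatives are pointwise at most `η`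
times the weight itself. -/
structure IsSlowlyVarying (η : ℝ) (w : E → ℝ) : Prop where
  hasTemperateGrowth : w.HasTemperateGrowth
  abs_fderiv_le : ∀ x v, |fderiv ℝ w x v| ≤ η * ‖v‖ * |w x|
  abs_fderiv_fderiv_le : ∀ x u v,
    |fderiv ℝ (fun y => fderiv ℝ w y v) x u| ≤ η * ‖u‖ * ‖v‖ * |w x|

namespace IsSlowlyVarying

variable {η : ℝ} {w : E → ℝ}

theorem norm_lineDerivOp_sub_le (hw : IsSlowlyVarying η w) {v : E} (hv : ‖v‖ = 1)
    (f : 𝓢(E, F)) :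
    ‖schwartzToL2 (∂_{v} (schwartzMul w f) - schwartzMul w (∂_{v} f))‖ ≤
      η * ‖schwartzToL2 (schwartzMul w f)‖ := by
  have hw₁ := hasTemperateGrowth_fderiv_apply hw.hasTemperateGrowth v
  rw [lineDerivOp_schwartzMul hw.hasTemperateGrowth hw₁ fun _ => rfl, add_sub_cancel_left]
  exact norm_schwartzMul_le hw₁ hw.hasTemperateGrowth
    (fun x => by simpa [hv] using hw.abs_fderiv_le x v) f

theorem norm_lineDerivOp_lineDerivOp_sub_le (hw : IsSlowlyVarying η w) {u v : E}
    (hu : ‖u‖ = 1) (hv : ‖v‖ = 1) (f : 𝓢(E, F)) :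
    ‖schwartzToL2 (∂_{u} (∂_{v} (schwartzMul w f)) - schwartzMul w (∂_{u} (∂_{v} f)))‖ ≤
      η * ‖schwartzToL2 (schwartzMul w (∂_{v} f))‖ +
        η * ‖schwartzToL2 (schwartzMul w (∂_{u} f))‖ + η * ‖schwartzToL2 (schwartzMul w f)‖ := by
  have hw₁ := hasTemperateGrowth_fderiv_apply hw.hasTemperateGrowth
  have hw₂ := hasTemperateGrowth_fderiv_apply (hw₁ v) u
  have hleibniz : ∂_{u} (∂_{v} (schwartzMul w f)) - schwartzMul w (∂_{u} (∂_{v} f)) =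
      schwartzMul (fun x => fderiv ℝ w x u) (∂_{v} f) +
        schwartzMul (fun x => fderiv ℝ w x v) (∂_{u} f) +
        schwartzMul (fun x => fderiv ℝ (fun y => fderiv ℝ w y v) x u) f := by
    rw [lineDerivOp_schwartzMul hw.hasTemperateGrowth (hw₁ v) fun _ => rfl, lineDerivOp_add,
      lineDerivOp_schwartzMul hw.hasTemperateGrowth (hw₁ u) fun _ => rfl,
      lineDerivOp_schwartzMul (hw₁ v) hw₂ fun _ => rfl]
    abel
  rw [hleibniz, map_add, map_add]
  refine norm_add₃_le.trans (add_le_add_three ?_ ?_ ?_)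
  · exact norm_schwartzMul_le (hw₁ u) hw.hasTemperateGrowth
      (fun x => by simpa [hu] using hw.abs_fderiv_le x u) _
  · exact norm_schwartzMul_le (hw₁ v) hw.hasTemperateGrowth
      (fun x => by simpa [hv] using hw.abs_fderiv_le x v) _
  · exact norm_schwartzMul_le hw₂ hw.hasTemperateGrowth
      (fun x => by simpa [hu, hv] using hw.abs_fderiv_fderiv_le x u v) _

variable [Fintype ι] (b : OrthonormalBasis ι ℝ E)

theorem norm_schwartzMul_lineDerivOp_le (hw : IsSlowlyVarying η w) (hη₁ : η ≤ 1)
    (i : ι) (f : 𝓢(E, F)) :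
    ‖schwartzToL2 (schwartzMul w (∂_{b i} f))‖ ≤
      2 * ‖schwartzToL2 (helmholtz (schwartzMul w f))‖ := by
  have hcomm := hw.norm_lineDerivOp_sub_le (b.norm_eq_one i) f
  rw [map_sub] at hcomm
  have htri := norm_le_norm_add_norm_sub (schwartzToL2 (∂_{b i} (schwartzMul w f)))
    (schwartzToL2 (schwartzMul w (∂_{b i} f)))
  have hη := mul_le_of_le_one_left (norm_nonneg (schwartzToL2 (schwartzMul w f))) hη₁
  linarith [norm_lineDerivOp_le b i (schwartzMul w f), norm_le_norm_helmholtz (schwartzMul w f)]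

theorem norm_lineDerivOp_lineDerivOp_sub_le_helmholtz (hw : IsSlowlyVarying η w) (hη₀ : 0 ≤ η)
    (hη₁ : η ≤ 1) (i j : ι) (f : 𝓢(E, F)) :
    ‖schwartzToL2 (∂_{b i} (∂_{b j} (schwartzMul w f)) - schwartzMul w (∂_{b i} (∂_{b j} f)))‖ ≤
      5 * η * ‖schwartzToL2 (helmholtz (schwartzMul w f))‖ :=
  calc _ ≤ _ := hw.norm_lineDerivOp_lineDerivOp_sub_le (b.norm_eq_one i) (b.norm_eq_one j) f
    _ ≤ η * (2 * ‖schwartzToL2 (helmholtz (schwartzMul w f))‖) +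
        η * (2 * ‖schwartzToL2 (helmholtz (schwartzMul w f))‖) +
        η * ‖schwartzToL2 (helmholtz (schwartzMul w f))‖ := by
      gcongr
      exacts [hw.norm_schwartzMul_lineDerivOp_le b hη₁ j f,
        hw.norm_schwartzMul_lineDerivOp_le b hη₁ i f, norm_le_norm_helmholtz _]
    _ = _ := by ring

theorem norm_helmholtz_schwartzMul_le (hw : IsSlowlyVarying η w) (hη₀ : 0 ≤ η)
    (hη : 10 * (Module.finrank ℝ E + 1) * η ≤ 1) (f : 𝓢(E, F)) :
    ‖schwartzToL2 (helmholtz (schwartzMul w f))‖ ≤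
      2 * ‖schwartzToL2 (schwartzMul w (helmholtz f))‖ := by
  set b := stdOrthonormalBasis ℝ E
  set N := ‖schwartzToL2 (helmholtz (schwartzMul w f))‖ with hN
  have hη₁ : η ≤ 1 := by nlinarith [(Module.finrank ℝ E).cast_nonneg (α := ℝ)]
  have hcomm : helmholtz (schwartzMul w f) = schwartzMul w (helmholtz f) +
      ∑ i, (∂_{b i} (∂_{b i} (schwartzMul w f)) - schwartzMul w (∂_{b i} (∂_{b i} f))) := by
    rw [helmholtz_eq_sum b, helmholtz_eq_sum b, map_sub, map_sum, Finset.sum_sub_distrib]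
    abel
  have herr : N ≤ ‖schwartzToL2 (schwartzMul w (helmholtz f))‖ +
      Module.finrank ℝ E * (5 * η * N) := by
    conv_lhs => rw [hN, hcomm, map_add, map_sum]
    refine (norm_add_le _ _).trans (add_le_add_right ((norm_sum_le_of_le _ fun i _ =>
      hw.norm_lineDerivOp_lineDerivOp_sub_le_helmholtz b hη₀ hη₁ i i f).trans_eq ?_) _)
    rw [Finset.sum_const, Finset.card_univ, Fintype.card_fin, nsmul_eq_mul]
  nlinarith [norm_nonneg (schwartzToL2 (helmholtz (schwartzMul w f)))]

end IsSlowlyVarying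

/-- The `H²` estimate for `Δ - 1` in the space `L²` with weight `w`, with constant `C`. -/
structure HelmholtzEstimate (F : Type*) [NormedAddCommGroup F] [InnerProductSpace ℂ F]
    (b : ι → E) (w : E → ℝ) (C : ℝ) : Prop where
  le : ∀ f : 𝓢(E, F), ‖schwartzToL2 (schwartzMul w f)‖ ≤
    C * ‖schwartzToL2 (schwartzMul w (helmholtz f))‖
  deriv_le : ∀ i (f : 𝓢(E, F)), ‖schwartzToL2 (schwartzMul w (∂_{b i} f))‖ ≤
    C * ‖schwartzToL2 (schwartzMul w (helmholtz f))‖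
  deriv_deriv_le : ∀ i j (f : 𝓢(E, F)), ‖schwartzToL2 (schwartzMul w (∂_{b i} (∂_{b j} f)))‖ ≤
    C * ‖schwartzToL2 (schwartzMul w (helmholtz f))‖

theorem IsSlowlyVarying.helmholtzEstimate [Fintype ι] {η : ℝ} {w : E → ℝ}
    (hw : IsSlowlyVarying η w) (hη₀ : 0 ≤ η) (hη : 10 * (Module.finrank ℝ E + 1) * η ≤ 1)
    (b : OrthonormalBasis ι ℝ E) : HelmholtzEstimate F b w 4 := by
  have hη₁ : 10 * η ≤ 1 := by nlinarith [(Module.finrank ℝ E).cast_nonneg (α := ℝ)]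
  have hη' : η ≤ 1 := by linarith
  refine ⟨fun f => ?_, fun i f => ?_, fun i j f => ?_⟩ <;>
    have hmain := hw.norm_helmholtz_schwartzMul_le hη₀ hη f
  · linarith [norm_le_norm_helmholtz (schwartzMul w f),
      norm_nonneg (schwartzToL2 (schwartzMul w f))]
  · linarith [hw.norm_schwartzMul_lineDerivOp_le b hη' i f]
  · have herr := hw.norm_lineDerivOp_lineDerivOp_sub_le_helmholtz b hη₀ hη' i j f
    rw [map_sub] at herr
    have htri := norm_le_norm_add_norm_sub (schwartzToL2 (∂_{b i} (∂_{b j} (schwartzMul w f))))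
      (schwartzToL2 (schwartzMul w (∂_{b i} (∂_{b j} f))))
    nlinarith [norm_lineDerivOp_lineDerivOp_le b i j (schwartzMul w f),
      norm_nonneg (schwartzToL2 (helmholtz (schwartzMul w f)))]

theorem HelmholtzEstimate.of_le_of_le {b : ι → E} {w w' : E → ℝ} {C K : ℝ}
    (h : HelmholtzEstimate F b w C) (hC : 0 ≤ C) (hK : 0 ≤ K) (hw : w.HasTemperateGrowth)
    (hw' : w'.HasTemperateGrowth) (hle : ∀ x, |w' x| ≤ K * |w x|)
    (hle' : ∀ x, |w x| ≤ K * |w' x|) : HelmholtzEstimate F b w' (K * (C * K)) := by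
  have hcomp : ∀ f g : 𝓢(E, F), ‖schwartzToL2 (schwartzMul w f)‖ ≤
      C * ‖schwartzToL2 (schwartzMul w g)‖ → ‖schwartzToL2 (schwartzMul w' f)‖ ≤
      K * (C * K) * ‖schwartzToL2 (schwartzMul w' g)‖ := fun f g hfg =>
    calc _ ≤ K * ‖schwartzToL2 (schwartzMul w f)‖ := norm_schwartzMul_le hw' hw hle f
      _ ≤ K * (C * (K * ‖schwartzToL2 (schwartzMul w' g)‖)) := by
        gcongr
        exact hfg.trans (mul_le_mul_of_nonneg_left (norm_schwartzMul_le hw hw' hle' g) hC)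
      _ = _ := by ring
  exact ⟨fun f => hcomp _ _ (h.le f), fun i f => hcomp _ _ (h.deriv_le i f),
    fun i j f => hcomp _ _ (h.deriv_deriv_le i j f)⟩

end SlowlyVarying

/-! ### The weights `(R² + |x|²)^t` -/

section ShiftedWeight

variable {E F ι : Type*} [NormedAddCommGroup E]

/-- The weight `(R² + |x|²)^t`; its logarithmic derivatives are small when `R` is large. -/
def shiftedWeight (R t : ℝ) (x : E) : ℝ := (R ^ 2 + ‖x‖ ^ 2) ^ t

theorem shiftedWeight_nonneg (R t : ℝ) (x : E) : 0 ≤ shiftedWeight R t x := by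
  unfold shiftedWeight
  positivity

theorem rpow_le_rpow_abs_mul_rpow {p q K : ℝ} (hp : 0 < p) (hq : 0 < q) (hpq : p ≤ K * q)
    (hqp : q ≤ K * p) (t : ℝ) : p ^ t ≤ K ^ |t| * q ^ t := by
  rcases abs_cases t with ⟨h, ht⟩ | ⟨h, ht⟩ <;> rw [h]
  · rw [← Real.mul_rpow (by nlinarith) hq.le]
    exact Real.rpow_le_rpow hp.le hpq ht
  · have hK : 0 < K := pos_of_mul_pos_left (hp.trans_le hpq) hq.le
    rw [Real.rpow_neg hK.le, ← Real.inv_rpow hK.le, ← Real.mul_rpow (by positivity) hq.le]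
    refine Real.rpow_le_rpow_of_nonpos (by positivity) ?_ ht.le
    rwa [inv_mul_le_iff₀ hK]

theorem shiftedWeight_le_shiftedWeight_one {R : ℝ} (hR : 1 ≤ R) (t : ℝ) (x : E) :
    shiftedWeight R t x ≤ (R ^ 2) ^ |t| * shiftedWeight 1 t x ∧
      shiftedWeight 1 t x ≤ (R ^ 2) ^ |t| * shiftedWeight R t x := by
  have hR2 : 1 ≤ R ^ 2 := one_le_pow₀ hR
  have hle : R ^ 2 + ‖x‖ ^ 2 ≤ R ^ 2 * (1 ^ 2 + ‖x‖ ^ 2) := by nlinarith [sq_nonneg ‖x‖]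
  have hge : 1 ^ 2 + ‖x‖ ^ 2 ≤ R ^ 2 * (R ^ 2 + ‖x‖ ^ 2) := by nlinarith [sq_nonneg ‖x‖]
  exact ⟨rpow_le_rpow_abs_mul_rpow (by positivity) (by positivity) hle hge t,
    rpow_le_rpow_abs_mul_rpow (by positivity) (by positivity) hge hle t⟩

section

variable {R : ℝ} (hR : 0 < R)
include hR

theorem norm_mul_shiftedWeight_sub_one_le (t : ℝ) (x : E) :
    R * ‖x‖ * shiftedWeight R (t - 1) x ≤ shiftedWeight R t x := by
  have hq : 0 < R ^ 2 + ‖x‖ ^ 2 := by positivity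
  rw [shiftedWeight, Real.rpow_sub_one hq.ne', mul_div_assoc', div_le_iff₀ hq, shiftedWeight,
    mul_comm]
  gcongr
  nlinarith [sq_nonneg (R - ‖x‖), mul_nonneg hR.le (norm_nonneg x)]

theorem sq_mul_shiftedWeight_sub_one_le (t : ℝ) (x : E) :
    R ^ 2 * shiftedWeight R (t - 1) x ≤ shiftedWeight R t x := by
  have hq : 0 < R ^ 2 + ‖x‖ ^ 2 := by positivity
  rw [shiftedWeight, Real.rpow_sub_one hq.ne', mul_div_assoc', div_le_iff₀ hq, shiftedWeight,
    mul_comm]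
  gcongr
  exact le_add_of_nonneg_right (sq_nonneg _)

variable [InnerProductSpace ℝ E]

theorem hasTemperateGrowth_shiftedWeight (t : ℝ) :
    (shiftedWeight (E := E) R t).HasTemperateGrowth := by
  have hscale : shiftedWeight (E := E) R t = fun x => (R ^ 2) ^ t * (1 + ‖R⁻¹ • x‖ ^ 2) ^ t := by
    funext x
    rw [shiftedWeight, ← Real.mul_rpow (by positivity) (by positivity), norm_smul, norm_inv,
      Real.norm_of_nonneg hR.le]
    field_simp
  have hone := (Function.hasTemperateGrowth_one_add_norm_sq_rpow E t).comp
    (R⁻¹ • ContinuousLinearMap.id ℝ E).hasTemperateGrowth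
  rw [hscale]
  exact (Function.HasTemperateGrowth.const _).mul hone

theorem fderiv_shiftedWeight (t : ℝ) (x v : E) :
    fderiv ℝ (shiftedWeight R t) x v = 2 * t * inner ℝ x v * shiftedWeight R (t - 1) x := by
  have hq : R ^ 2 + ‖x‖ ^ 2 ≠ 0 := by positivity
  have h := (((hasStrictFDerivAt_norm_sq x).hasFDerivAt.const_add (R ^ 2)).rpow_const
    (p := t) (Or.inl hq)).fderiv
  unfold shiftedWeight
  rw [h]
  simp only [smul_apply, innerSL_apply_apply, smul_eq_mul, nsmul_eq_mul, Nat.cast_ofNat]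
  ring

theorem fderiv_fderiv_shiftedWeight (t : ℝ) (x u v : E) :
    fderiv ℝ (fun y => fderiv ℝ (shiftedWeight R t) y v) x u =
      2 * t * inner ℝ u v * shiftedWeight R (t - 1) x +
        4 * t * (t - 1) * inner ℝ x u * inner ℝ x v * shiftedWeight R (t - 2) x := by
  have hw : DifferentiableAt ℝ (shiftedWeight R (t - 1)) x :=
    (hasTemperateGrowth_shiftedWeight hR (t - 1)).1.differentiable (by simp) x
  have hinner : HasFDerivAt (fun y : E => 2 * t * inner ℝ y v) ((2 * t) • innerSL ℝ v) x := by
    simpa only [innerSL_apply_apply, real_inner_comm] using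
      (innerSL ℝ v).hasFDerivAt.const_mul (2 * t)
  simp only [fderiv_shiftedWeight hR]
  rw [(hinner.fun_mul hw.hasFDerivAt).fderiv]
  simp only [add_apply, smul_apply, smul_eq_mul, fderiv_shiftedWeight hR, innerSL_apply_apply,
    real_inner_comm u v, show t - 1 - 1 = t - 2 by ring]
  ring

theorem abs_fderiv_shiftedWeight_le (t : ℝ) (x v : E) :
    |fderiv ℝ (shiftedWeight R t) x v| ≤ 2 * |t| / R * ‖v‖ * shiftedWeight R t x := by
  have hw := shiftedWeight_nonneg R (t - 1) x
  rw [fderiv_shiftedWeight hR, abs_mul, abs_mul, abs_mul, abs_two, abs_of_nonneg hw]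
  calc _ ≤ 2 * |t| * (‖x‖ * ‖v‖) * shiftedWeight R (t - 1) x := by
        gcongr
        exact abs_real_inner_le_norm x v
    _ = 2 * |t| / R * ‖v‖ * (R * ‖x‖ * shiftedWeight R (t - 1) x) := by field_simp
    _ ≤ _ := by
        gcongr
        exact norm_mul_shiftedWeight_sub_one_le hR t x

theorem abs_fderiv_fderiv_shiftedWeight_le (t : ℝ) (x u v : E) :
    |fderiv ℝ (fun y => fderiv ℝ (shiftedWeight R t) y v) x u| ≤
      (2 * |t| + 4 * |t| * |t - 1|) / R ^ 2 * ‖u‖ * ‖v‖ * shiftedWeight R t x := by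
  have hw₁ := shiftedWeight_nonneg R (t - 1) x
  have hw₂ := shiftedWeight_nonneg R (t - 2) x
  have hquad : ‖x‖ * ‖x‖ * shiftedWeight R (t - 2) x ≤ shiftedWeight R t x / R ^ 2 := by
    have hx := norm_mul_shiftedWeight_sub_one_le hR (t - 1) x
    rw [show t - 1 - 1 = t - 2 by ring] at hx
    rw [le_div_iff₀ (by positivity)]
    nlinarith [norm_mul_shiftedWeight_sub_one_le hR t x,
      mul_le_mul_of_nonneg_left hx (mul_nonneg hR.le (norm_nonneg x))]
  have hlin : shiftedWeight R (t - 1) x ≤ shiftedWeight R t x / R ^ 2 := by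
    rw [le_div_iff₀' (by positivity)]
    exact sq_mul_shiftedWeight_sub_one_le hR t x
  rw [fderiv_fderiv_shiftedWeight hR]
  refine (abs_add_le _ _).trans ?_
  simp only [abs_mul, abs_two, abs_of_nonneg hw₁, abs_of_nonneg hw₂, abs_of_pos (four_pos (α := ℝ))]
  calc _ ≤ 2 * |t| * (‖u‖ * ‖v‖) * shiftedWeight R (t - 1) x +
        4 * |t| * |t - 1| * (‖x‖ * ‖u‖) * (‖x‖ * ‖v‖) * shiftedWeight R (t - 2) x := by
        gcongr <;> exact abs_real_inner_le_norm _ _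
    _ = 2 * |t| * (‖u‖ * ‖v‖) * shiftedWeight R (t - 1) x +
        4 * |t| * |t - 1| * (‖u‖ * ‖v‖) * (‖x‖ * ‖x‖ * shiftedWeight R (t - 2) x) := by ring
    _ ≤ 2 * |t| * (‖u‖ * ‖v‖) * (shiftedWeight R t x / R ^ 2) +
        4 * |t| * |t - 1| * (‖u‖ * ‖v‖) * (shiftedWeight R t x / R ^ 2) := by gcongr
    _ = _ := by ring

end

variable [InnerProductSpace ℝ E]

theorem isSlowlyVarying_shiftedWeight {R : ℝ} (hR : 1 ≤ R) (t : ℝ) :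
    IsSlowlyVarying ((2 * |t| + 4 * |t| * |t - 1|) / R) (shiftedWeight (E := E) R t) where
  hasTemperateGrowth := hasTemperateGrowth_shiftedWeight (by positivity) t
  abs_fderiv_le x v := by
    rw [abs_of_nonneg (shiftedWeight_nonneg R t x)]
    refine (abs_fderiv_shiftedWeight_le (by positivity) t x v).trans ?_
    have := shiftedWeight_nonneg R t x
    gcongr
    exact le_add_of_nonneg_right (by positivity)
  abs_fderiv_fderiv_le x u v := by
    rw [abs_of_nonneg (shiftedWeight_nonneg R t x)]
    refine (abs_fderiv_fderiv_shiftedWeight_le (by positivity) t x u v).trans ?_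
    have := shiftedWeight_nonneg R t x
    gcongr
    exact le_self_pow₀ hR two_ne_zero

variable [FiniteDimensional ℝ E] [MeasurableSpace E] [BorelSpace E]
  [NormedAddCommGroup F] [InnerProductSpace ℂ F]

theorem exists_helmholtzEstimate_shiftedWeight_one [Fintype ι] (b : OrthonormalBasis ι ℝ E)
    (t : ℝ) : ∃ C, 0 ≤ C ∧ HelmholtzEstimate F b (shiftedWeight 1 t) C := by
  set c := 2 * |t| + 4 * |t| * |t - 1|
  set D : ℝ := 10 * (Module.finrank ℝ E + 1)
  have : 0 ≤ c := by positivity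
  have : 0 ≤ D := by positivity
  have hR : 1 ≤ D * c + 1 := le_add_of_nonneg_left (by positivity)
  have hη : D * (c / (D * c + 1)) ≤ 1 := by
    rw [mul_div_assoc', div_le_one (by positivity)]
    exact le_add_of_nonneg_right one_pos.le
  refine ⟨_, ?_, ((isSlowlyVarying_shiftedWeight hR t).helmholtzEstimate (by positivity)
    hη b).of_le_of_le (K := ((D * c + 1) ^ 2) ^ |t|) (by positivity) (by positivity)
      (hasTemperateGrowth_shiftedWeight (by positivity) t)
      (hasTemperateGrowth_shiftedWeight one_pos t) (fun x => ?_) fun x => ?_⟩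
  · positivity
  · simpa only [abs_of_nonneg (shiftedWeight_nonneg _ t x)] using
      (shiftedWeight_le_shiftedWeight_one hR t x).2
  · simpa only [abs_of_nonneg (shiftedWeight_nonneg _ t x)] using
      (shiftedWeight_le_shiftedWeight_one hR t x).1

end ShiftedWeight

/-! ### Inversion of `Δ - 1` on Schwartz functions -/

section Multiplier

variable {E F : Type*} [NormedAddCommGroup E] [InnerProductSpace ℝ E]

theorem hasTemperateGrowth_one_add_norm_sq_smul_rpow (c t : ℝ) :
    (fun ξ : E => (1 + ‖c • ξ‖ ^ 2) ^ t).HasTemperateGrowth :=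
  (Function.hasTemperateGrowth_one_add_norm_sq_rpow E t).comp
    (c • ContinuousLinearMap.id ℝ E).hasTemperateGrowth

variable [FiniteDimensional ℝ E] [MeasurableSpace E] [BorelSpace E] [NormedAddCommGroup F]
  [InnerProductSpace ℂ F] [CompleteSpace F]

/-- The Fourier multiplier with symbol `(1 + |2πξ|²)^t` on Schwartz functions; it is `(1 - Δ)^t`. -/
def helmholtzPower (t : ℝ) : 𝓢(E, F) →L[ℝ] 𝓢(E, F) :=
  fourierMultiplierCLM F fun ξ => (1 + ‖(2 * Real.pi) • ξ‖ ^ 2) ^ t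

theorem helmholtzPower_helmholtzPower (s t : ℝ) (f : 𝓢(E, F)) :
    helmholtzPower s (helmholtzPower t f) = helmholtzPower (s + t) f := by
  rw [helmholtzPower, helmholtzPower, helmholtzPower,
    fourierMultiplierCLM_fourierMultiplierCLM_apply
      (hasTemperateGrowth_one_add_norm_sq_smul_rpow _ s)
      (hasTemperateGrowth_one_add_norm_sq_smul_rpow _ t)]
  congr 2
  funext ξ
  exact (Real.rpow_add (by positivity) s t).symm

theorem helmholtzPower_zero (f : 𝓢(E, F)) : helmholtzPower 0 f = f := by
  simp [helmholtzPower]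

theorem helmholtzPower_one (f : 𝓢(E, F)) : helmholtzPower 1 f = -helmholtz f := by
  have hsymbol : (fun ξ : E => (1 + ‖(2 * Real.pi) • ξ‖ ^ 2) ^ (1 : ℝ)) =
      (fun _ => 1) + (2 * Real.pi) ^ 2 • fun ξ : E => ‖ξ‖ ^ 2 := by
    funext ξ
    simp [norm_smul, mul_pow]
  have hnorm := Function.hasTemperateGrowth_norm_sq E
  have hsmul : ((2 * Real.pi) ^ 2 • fun ξ : E => ‖ξ‖ ^ 2).HasTemperateGrowth :=
    (Function.HasTemperateGrowth.const _).mul hnorm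
  have hadd : fourierMultiplierCLM F ((fun _ => 1) + (2 * Real.pi) ^ 2 • fun ξ : E => ‖ξ‖ ^ 2) f =
      fourierMultiplierCLM F (fun _ => (1 : ℝ)) f +
        fourierMultiplierCLM F ((2 * Real.pi) ^ 2 • fun ξ : E => ‖ξ‖ ^ 2) f := by
    simp only [fourierMultiplierCLM_apply]
    rw [smulLeftCLM_add (g₁ := fun _ => 1) (.const 1) hsmul, add_apply,
      FourierTransform.fourierInv_add]
  rw [helmholtzPower, hsymbol, hadd, fourierMultiplierCLM_const,
    fourierMultiplierCLM_smul hnorm, helmholtz_apply, laplacian_eq_fourierMultiplierCLM, neg_sub,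
    neg_smul, sub_neg_eq_add, one_smul]
  rfl

/-- The operator `Δ - 1` as an automorphism of the Schwartz space. -/
def helmholtzEquiv : 𝓢(E, F) ≃ₗ[ℂ] 𝓢(E, F) :=
  LinearEquiv.ofBijective (helmholtz : 𝓢(E, F) →L[ℂ] 𝓢(E, F)).toLinearMap <| by
    have hpower : ∀ f : 𝓢(E, F), helmholtz f = -helmholtzPower 1 f := fun f => by
      rw [helmholtzPower_one, neg_neg]
    refine Function.bijective_iff_has_inverse.2 ⟨fun f => -helmholtzPower (-1) f, fun f => ?_,
      fun f => ?_⟩ <;>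
    simp [hpower, helmholtzPower_helmholtzPower, helmholtzPower_zero]

theorem helmholtzEquiv_apply (f : 𝓢(E, F)) : helmholtzEquiv f = helmholtz f :=
  rfl

end Multiplier

/-! ### Estimates for weighted jets -/

section Jet

theorem bracket_pos (x : Plane) : 0 < bracket x :=
  Real.sqrt_pos.2 (by positivity)

theorem bracket_rpow (γ : ℝ) :
    (fun x => bracket x ^ γ) = shiftedWeight 1 (γ / 2) := by
  funext x
  rw [bracket, shiftedWeight, Real.sqrt_eq_rpow, ← Real.rpow_mul (by positivity), one_pow,
    one_div_mul_eq_div]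

theorem hasTemperateGrowth_bracket_rpow (γ : ℝ) :
    (fun x => bracket x ^ γ).HasTemperateGrowth :=
  bracket_rpow γ ▸ hasTemperateGrowth_shiftedWeight one_pos _

theorem exists_helmholtzEstimate_bracket (γ : ℝ) : ∃ C, 0 ≤ C ∧
    HelmholtzEstimate ℂ (fun i => EuclideanSpace.single i 1) (fun x => bracket x ^ γ) C := by
  have h := exists_helmholtzEstimate_shiftedWeight_one (F := ℂ)
    (EuclideanSpace.basisFun (Fin 2) ℝ) (γ / 2)
  rwa [funext (EuclideanSpace.basisFun_apply (Fin 2) ℝ), ← bracket_rpow] at h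

/-- The partial derivative `∂/∂xᵢ` on Schwartz functions on the plane. -/
def schwartzDeriv (i : Fin 2) : 𝓢(Plane, ℂ) →L[ℂ] 𝓢(Plane, ℂ) :=
  lineDerivOpCLM ℂ 𝓢(Plane, ℂ) (EuclideanSpace.single i (1 : ℝ))

theorem commute_schwartzDeriv (i j : Fin 2) : Commute (schwartzDeriv i) (schwartzDeriv j) :=
  ContinuousLinearMap.ext fun f => lineDerivOp_comm _ _ f

theorem commute_helmholtz_schwartzDeriv (i : Fin 2) : Commute helmholtz (schwartzDeriv i) :=
  ContinuousLinearMap.ext fun f => (lineDerivOp_helmholtz _ f).symm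

theorem helmholtz_eq_schwartzDeriv :
    helmholtz = schwartzDeriv 0 * schwartzDeriv 0 + schwartzDeriv 1 * schwartzDeriv 1 - 1 := by
  ext1 f
  rw [helmholtz_eq_sum (EuclideanSpace.basisFun (Fin 2) ℝ), Fin.sum_univ_two,
    EuclideanSpace.basisFun_apply, EuclideanSpace.basisFun_apply]
  rfl

/-- The operator `D^α` on Schwartz functions. -/
def schwartzMultiDeriv (α : ℕ × ℕ) : 𝓢(Plane, ℂ) →L[ℂ] 𝓢(Plane, ℂ) :=
  schwartzDeriv 0 ^ α.1 * schwartzDeriv 1 ^ α.2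

theorem coe_schwartzDeriv_pow (i : Fin 2) (k : ℕ) (f : 𝓢(Plane, ℂ)) :
    ((schwartzDeriv i ^ k) f : Plane → ℂ) = (pderiv i)^[k] f := by
  induction k with
  | zero => rfl
  | succ k ih =>
    rw [Function.iterate_succ_apply', ← ih, pow_succ']
    rfl

theorem coe_schwartzMultiDeriv (α : ℕ × ℕ) (f : 𝓢(Plane, ℂ)) :
    (schwartzMultiDeriv α f : Plane → ℂ) = multiDeriv α f := by
  rw [multiDeriv, ← coe_schwartzDeriv_pow, ← coe_schwartzDeriv_pow]
  rfl

theorem schwartzMultiDeriv_helmholtz (α : ℕ × ℕ) (f : 𝓢(Plane, ℂ)) :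
    schwartzMultiDeriv α (helmholtz f) = helmholtz (schwartzMultiDeriv α f) :=
  have h : Commute (schwartzMultiDeriv α) helmholtz :=
    ((commute_helmholtz_schwartzDeriv 0).symm.pow_left _).mul_left
      ((commute_helmholtz_schwartzDeriv 1).symm.pow_left _)
  DFunLike.congr_fun h.eq f

theorem schwartzDeriv_zero_mul_schwartzMultiDeriv (a b : ℕ) :
    schwartzDeriv 0 * schwartzMultiDeriv (a, b) = schwartzMultiDeriv (a + 1, b) := by
  simp only [schwartzMultiDeriv, pow_succ', mul_assoc]

theorem schwartzDeriv_one_mul_schwartzMultiDeriv (a b : ℕ) :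
    schwartzDeriv 1 * schwartzMultiDeriv (a, b) = schwartzMultiDeriv (a, b + 1) := by
  simp only [schwartzMultiDeriv, pow_succ', ← mul_assoc,
    ((commute_schwartzDeriv 1 0).pow_right a).eq]

theorem exists_schwartzMultiDeriv_eq_mul {s : ℕ} {α : ℕ × ℕ} (hα : α.1 + α.2 = s + 1) :
    ∃ (i : Fin 2) (β : ℕ × ℕ), β.1 + β.2 = s ∧
      schwartzMultiDeriv α = schwartzDeriv i * schwartzMultiDeriv β := by
  match α, hα with
  | (a + 1, b), h => exact
    ⟨0, (a, b), by grind, (schwartzDeriv_zero_mul_schwartzMultiDeriv a b).symm⟩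
  | (0, b + 1), h => exact
    ⟨1, (0, b), by grind, (schwartzDeriv_one_mul_schwartzMultiDeriv 0 b).symm⟩

/-- The map `f ↦ ⟨x⟩^γ D^α f` from Schwartz functions to `L²`. -/
def weightedDeriv (γ : ℝ) (α : ℕ × ℕ) : 𝓢(Plane, ℂ) →L[ℂ] Lp ℂ 2 (volume : Measure Plane) :=
  schwartzToL2 ∘L schwartzMul (fun x => bracket x ^ γ) ∘L schwartzMultiDeriv α

theorem weightedDeriv_apply (γ : ℝ) (α : ℕ × ℕ) (f : 𝓢(Plane, ℂ)) :
    weightedDeriv γ α f =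
      schwartzToL2 (schwartzMul (fun x => bracket x ^ γ) (schwartzMultiDeriv α f)) :=
  rfl

theorem coeFn_weightedDeriv (γ : ℝ) (α : ℕ × ℕ) (f : 𝓢(Plane, ℂ)) :
    weightedDeriv γ α f =ᵐ[volume] fun x => ((bracket x ^ γ : ℝ) : ℂ) * multiDeriv α f x := by
  refine (coeFn_toLp _ 2 volume).trans (.of_forall fun x => ?_)
  change schwartzMul _ (schwartzMultiDeriv α f) x = _
  rw [schwartzMul_apply (hasTemperateGrowth_bracket_rpow γ), coe_schwartzMultiDeriv,
    Complex.real_smul]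

theorem weightedDeriv_helmholtz (γ : ℝ) (α : ℕ × ℕ) (f : 𝓢(Plane, ℂ)) :
    weightedDeriv γ α (helmholtz f) = weightedDeriv γ (α.1 + 2, α.2) f +
      weightedDeriv γ (α.1, α.2 + 2) f - weightedDeriv γ α f := by
  rw [weightedDeriv_apply, schwartzMultiDeriv_helmholtz, helmholtz_eq_schwartzDeriv]
  simp only [weightedDeriv_apply, ← map_add, ← map_sub,
    ← schwartzDeriv_zero_mul_schwartzMultiDeriv, ← schwartzDeriv_one_mul_schwartzMultiDeriv]
  rfl

theorem norm_weightedDeriv_le_helmholtz {γ C : ℝ} (h : HelmholtzEstimate ℂ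
    (fun i => EuclideanSpace.single i 1) (fun x => bracket x ^ γ) C) {s : ℕ} {α : ℕ × ℕ}
    (hα : α.1 + α.2 ≤ s + 2) : ∃ β : MultiIndex s, ∀ f : 𝓢(Plane, ℂ),
      ‖weightedDeriv γ α f‖ ≤ C * ‖weightedDeriv γ β (helmholtz f)‖ := by
  simp only [weightedDeriv_apply, schwartzMultiDeriv_helmholtz]
  obtain hα | hα | hα : α.1 + α.2 ≤ s ∨ α.1 + α.2 = s + 1 ∨ α.1 + α.2 = s + 2 := by omega
  · exact ⟨⟨α, hα⟩, fun f => h.le _⟩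
  · obtain ⟨i, β, hβ, hαβ⟩ := exists_schwartzMultiDeriv_eq_mul hα
    exact ⟨⟨β, hβ.le⟩, fun f => hαβ ▸ h.deriv_le i _⟩
  · obtain ⟨i, β, hβ, hαβ⟩ := exists_schwartzMultiDeriv_eq_mul hα
    obtain ⟨j, δ, hδ, hβδ⟩ := exists_schwartzMultiDeriv_eq_mul hβ
    exact ⟨⟨δ, hδ.le⟩, fun f => hαβ ▸ hβδ ▸ h.deriv_deriv_le i j _⟩

/-- The weighted jet of a Schwartz function. -/
def schwartzJet (s : ℕ) (γ : ℝ) : 𝓢(Plane, ℂ) →ₗ[ℂ] JetSpace s :=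
  (WithLp.linearEquiv 1 ℂ (MultiIndex s → Lp ℂ 2 (volume : Measure Plane))).symm ∘ₗ
    LinearMap.pi fun α : MultiIndex s => (weightedDeriv γ α.1).toLinearMap

theorem schwartzJet_apply (s : ℕ) (γ : ℝ) (f : 𝓢(Plane, ℂ)) (α : MultiIndex s) :
    schwartzJet s γ f α = weightedDeriv γ α.1 f :=
  rfl

theorem isWeightedJet_schwartzJet (s : ℕ) (γ : ℝ) (f : 𝓢(Plane, ℂ)) :
    IsWeightedJet s γ f (schwartzJet s γ f) :=
  fun α => coeFn_weightedDeriv γ α.1 f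

theorem norm_weightedDeriv_le_schwartzJet {s : ℕ} {α : ℕ × ℕ} (hα : α.1 + α.2 ≤ s) (γ : ℝ)
    (f : 𝓢(Plane, ℂ)) : ‖weightedDeriv γ α f‖ ≤ ‖schwartzJet s γ f‖ :=
  PiLp.norm_apply_le (schwartzJet s γ f) ⟨α, hα⟩

theorem norm_jet_le_of_forall {s : ℕ} (v : JetSpace s) {c : ℝ} (h : ∀ α, ‖v α‖ ≤ c) :
    ‖v‖ ≤ Fintype.card (MultiIndex s) * c := by
  rw [PiLp.norm_eq_sum (by simp)]
  simpa using Finset.sum_le_card_nsmul Finset.univ (‖v ·‖) c fun α _ => h α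

theorem exists_norm_schwartzJet_helmholtz_le (s : ℕ) (γ : ℝ) : ∃ C : ℝ, ∀ f : 𝓢(Plane, ℂ),
    ‖schwartzJet s γ (helmholtz f)‖ ≤ C * ‖schwartzJet (s + 2) γ f‖ := by
  refine ⟨Fintype.card (MultiIndex s) * 3, fun f => ?_⟩
  rw [mul_assoc]
  refine norm_jet_le_of_forall _ fun ⟨α, hα⟩ => ?_
  have hle {β : ℕ × ℕ} (hβ : β.1 + β.2 ≤ s + 2) := norm_weightedDeriv_le_schwartzJet hβ γ f
  rw [schwartzJet_apply, weightedDeriv_helmholtz]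
  calc _ ≤ ‖weightedDeriv γ (α.1 + 2, α.2) f‖ + ‖weightedDeriv γ (α.1, α.2 + 2) f‖ +
        ‖weightedDeriv γ α f‖ := (norm_sub_le _ _).trans (by gcongr; exact norm_add_le _ _)
    _ ≤ _ := by
      linarith [hle (β := (α.1 + 2, α.2)) (by grind), hle (β := (α.1, α.2 + 2)) (by grind),
        hle (β := α) (by grind)]

theorem exists_norm_schwartzJet_le_helmholtz (s : ℕ) (γ : ℝ) : ∃ C : ℝ, ∀ f : 𝓢(Plane, ℂ),
    ‖schwartzJet (s + 2) γ f‖ ≤ C * ‖schwartzJet s γ (helmholtz f)‖ := by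
  obtain ⟨C, hC, h⟩ := exists_helmholtzEstimate_bracket γ
  refine ⟨Fintype.card (MultiIndex (s + 2)) * C, fun f => ?_⟩
  rw [mul_assoc]
  refine norm_jet_le_of_forall _ fun ⟨α, hα⟩ => ?_
  obtain ⟨β, hβ⟩ := norm_weightedDeriv_le_helmholtz h hα
  exact (hβ f).trans (mul_le_mul_of_nonneg_left (norm_weightedDeriv_le_schwartzJet β.2 γ _) hC)

end Jet

/-! ### Approximation of Schwartz functions by test functions -/

section Cutoff

variable {E F : Type*} [NormedAddCommGroup E] [InnerProductSpace ℝ E]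

/-- The dilated cutoff `x ↦ χ(εx)`. -/
def dilate (χ : E → ℝ) (ε : ℝ) (x : E) : ℝ := χ (ε • x)

theorem contDiff_dilate {χ : E → ℝ} (hχ : ContDiff ℝ ∞ χ) (ε : ℝ) : ContDiff ℝ ∞ (dilate χ ε) :=
  hχ.comp (contDiff_const_smul _)

theorem hasCompactSupport_dilate {χ : E → ℝ} (hχ : HasCompactSupport χ) {ε : ℝ} (hε : ε ≠ 0) :
    HasCompactSupport (dilate χ ε) :=
  hχ.comp_homeomorph (Homeomorph.smulOfNeZero ε hε)

theorem hasTemperateGrowth_dilate {χ : E → ℝ} (hχ : χ.HasTemperateGrowth) (ε : ℝ) :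
    (dilate χ ε).HasTemperateGrowth :=
  hχ.comp (ε • ContinuousLinearMap.id ℝ E).hasTemperateGrowth

theorem fderiv_dilate (χ : E → ℝ) (ε : ℝ) (x v : E) :
    fderiv ℝ (dilate χ ε) x v = ε * dilate (fun y => fderiv ℝ χ y v) ε x := by
  change fderiv ℝ (fun y => χ (ε • y)) x v = _
  rw [fderiv_comp_smul]
  rfl

theorem isTest_schwartzMul {χ : E → ℝ} (hχ : ContDiff ℝ ∞ χ) (hχc : HasCompactSupport χ)
    (f : 𝓢(E, ℂ)) : IsTest (schwartzMul χ f) := by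
  have hmul : (schwartzMul χ f : E → ℂ) = χ • ⇑f :=
    funext (schwartzMul_apply (hχc.hasTemperateGrowth hχ) f)
  exact ⟨(schwartzMul χ f).smooth ⊤, hmul ▸ hχc.smul_right⟩

variable [NormedAddCommGroup F] [InnerProductSpace ℂ F]

theorem lineDerivOp_schwartzMul_dilate {χ : E → ℝ} (hχ : χ.HasTemperateGrowth) (ε : ℝ) (v : E)
    (f : 𝓢(E, F)) : ∂_{v} (schwartzMul (dilate χ ε) f) = schwartzMul (dilate χ ε) (∂_{v} f) +
      (ε : ℂ) • schwartzMul (dilate (fun y => fderiv ℝ χ y v) ε) f := by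
  have hdχ := hasTemperateGrowth_dilate (hasTemperateGrowth_fderiv_apply hχ v) ε
  have hεdχ := (Function.HasTemperateGrowth.const ε).mul hdχ
  rw [lineDerivOp_schwartzMul (hasTemperateGrowth_dilate hχ ε) hεdχ fun x => fderiv_dilate χ ε x v]
  congr 1
  ext x
  rw [schwartzMul_apply hεdχ, smul_apply, schwartzMul_apply hdχ, Pi.mul_apply, mul_smul,
    Complex.coe_smul]

variable [MeasurableSpace E] [BorelSpace E] [FiniteDimensional ℝ E]

theorem norm_schwartzMul_dilate_sub_le {χ : E → ℝ} (hχ : χ.HasTemperateGrowth) {L : NNReal}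
    (hL : LipschitzWith L χ) (ε : ℝ) (f : 𝓢(E, F)) :
    ‖schwartzToL2 (schwartzMul (dilate χ ε) f) - (χ 0 : ℂ) • schwartzToL2 f‖ ≤
      L * |ε| * ‖schwartzToL2 (schwartzMul (shiftedWeight 1 (1 / 2)) f)‖ := by
  have hsub : (fun x => dilate χ ε x - χ 0).HasTemperateGrowth :=
    (hasTemperateGrowth_dilate hχ ε).sub (.const _)
  have hdiff : schwartzMul (dilate χ ε) f - (χ 0 : ℂ) • f =
      schwartzMul (fun x => dilate χ ε x - χ 0) f := by
    ext x
    simp [schwartzMul_apply (hasTemperateGrowth_dilate hχ ε), schwartzMul_apply hsub, sub_smul]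
  rw [← map_smul, ← map_sub, hdiff]
  refine norm_schwartzMul_le hsub (hasTemperateGrowth_shiftedWeight one_pos _) (fun x => ?_) f
  have hx : ‖x‖ ≤ |shiftedWeight 1 (1 / 2) x| := by
    rw [abs_of_nonneg (shiftedWeight_nonneg _ _ _), shiftedWeight, ← Real.sqrt_eq_rpow]
    exact Real.le_sqrt_of_sq_le (by linarith)
  calc |χ (ε • x) - χ 0| ≤ L * ‖ε • x - 0‖ := by
        simpa [dist_eq_norm] using hL.dist_le_mul (ε • x) 0
    _ = L * |ε| * ‖x‖ := by rw [sub_zero, norm_smul, Real.norm_eq_abs, mul_assoc]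
    _ ≤ _ := by gcongr

theorem tendsto_schwartzMul_dilate {χ : E → ℝ} (hχ : χ.HasTemperateGrowth) {L : NNReal}
    (hL : LipschitzWith L χ) (f : 𝓢(E, F)) :
    Tendsto (fun ε => schwartzToL2 (schwartzMul (dilate χ ε) f)) (𝓝 0)
      (𝓝 ((χ 0 : ℂ) • schwartzToL2 f)) := by
  rw [tendsto_iff_norm_sub_tendsto_zero]
  refine squeeze_zero (fun _ => norm_nonneg _)
    (fun ε => norm_schwartzMul_dilate_sub_le hχ hL ε f) ?_
  simpa using ((continuous_abs.tendsto (0 : ℝ)).const_mul (L : ℝ)).mul_const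
    ‖schwartzToL2 (schwartzMul (shiftedWeight 1 (1 / 2)) f)‖

/-- Convergence `A (χ(ε·) f) → χ(0) A f` in `L²` as `ε → 0`, for all cutoffs `χ`. -/
def CutoffTendsto (A : 𝓢(E, F) →L[ℂ] 𝓢(E, F)) : Prop :=
  ∀ χ : E → ℝ, ContDiff ℝ ∞ χ → HasCompactSupport χ → ∀ f : 𝓢(E, F),
    Tendsto (fun ε => schwartzToL2 (A (schwartzMul (dilate χ ε) f))) (𝓝 0)
      (𝓝 ((χ 0 : ℂ) • schwartzToL2 (A f)))

theorem cutoffTendsto_schwartzMul {g : E → ℝ} (hg : g.HasTemperateGrowth) :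
    CutoffTendsto (schwartzMul (F := F) g) := by
  intro χ hχ hχc f
  have hgrowth := hχc.hasTemperateGrowth hχ
  obtain ⟨L, hL⟩ := (hχ.of_le (by simp : (1 : WithTop ℕ∞) ≤ ∞)).lipschitzWith_of_hasCompactSupport
    hχc (by simp)
  have hcomm : ∀ ε, schwartzMul g (schwartzMul (dilate χ ε) f) =
      schwartzMul (dilate χ ε) (schwartzMul g f) := fun ε => by
    ext x
    simp only [schwartzMul_apply hg, schwartzMul_apply (hasTemperateGrowth_dilate hgrowth ε)]
    exact smul_comm _ _ _
  simpa only [hcomm] using tendsto_schwartzMul_dilate hgrowth hL (schwartzMul g f)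

namespace CutoffTendsto

variable {A : 𝓢(E, F) →L[ℂ] 𝓢(E, F)}

theorem mul_lineDerivOpCLM (hA : CutoffTendsto A) (v : E) :
    CutoffTendsto (A * lineDerivOpCLM ℂ 𝓢(E, F) v) := by
  intro χ hχ hχc f
  have hdχ : ContDiff ℝ ∞ fun x => fderiv ℝ χ x v :=
    (hχ.fderiv_right (by simp)).clm_apply contDiff_const
  have hdχc : HasCompactSupport fun x => fderiv ℝ χ x v := hχc.fderiv_apply ℝ v
  have hleibniz (ε : ℝ) : schwartzToL2 (A (∂_{v} (schwartzMul (dilate χ ε) f))) =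
      schwartzToL2 (A (schwartzMul (dilate χ ε) (∂_{v} f))) +
        (ε : ℂ) • schwartzToL2 (A (schwartzMul (dilate (fun y => fderiv ℝ χ y v) ε) f)) := by
    rw [lineDerivOp_schwartzMul_dilate (hχc.hasTemperateGrowth hχ), map_add, map_add,
      map_smul, map_smul]
  change Tendsto (fun ε => schwartzToL2 (A (∂_{v} (schwartzMul (dilate χ ε) f)))) _ _
  simp only [hleibniz]
  simpa using (hA χ hχ hχc (∂_{v} f)).add
    ((Complex.continuous_ofReal.tendsto 0).smul (hA _ hdχ hdχc f))

theorem mul_lineDerivOpCLM_pow (hA : CutoffTendsto A) (v : E) (k : ℕ) :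
    CutoffTendsto (A * lineDerivOpCLM ℂ 𝓢(E, F) v ^ k) := by
  induction k with
  | zero => simpa using hA
  | succ k ih =>
    rw [pow_succ, ← mul_assoc]
    exact ih.mul_lineDerivOpCLM v

end CutoffTendsto

theorem cutoffTendsto_bracket_mul_schwartzMultiDeriv (γ : ℝ) (α : ℕ × ℕ) :
    CutoffTendsto (schwartzMul (fun x => bracket x ^ γ) * schwartzMultiDeriv α) := by
  rw [schwartzMultiDeriv, ← mul_assoc]
  exact ((cutoffTendsto_schwartzMul
    (hasTemperateGrowth_bracket_rpow γ)).mul_lineDerivOpCLM_pow _ α.1).mul_lineDerivOpCLM_pow _ α.2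

theorem tendsto_schwartzJet_dilate {χ : Plane → ℝ} (hχ : ContDiff ℝ ∞ χ)
    (hχc : HasCompactSupport χ) (hχ₀ : χ 0 = 1) (s : ℕ) (γ : ℝ) (f : 𝓢(Plane, ℂ)) :
    Tendsto (fun ε => schwartzJet s γ (schwartzMul (dilate χ ε) f)) (𝓝 0)
      (𝓝 (schwartzJet s γ f)) := by
  have hpi : Tendsto (fun ε => WithLp.ofLp (schwartzJet s γ (schwartzMul (dilate χ ε) f))) (𝓝 0)
      (𝓝 (WithLp.ofLp (schwartzJet s γ f))) := tendsto_pi_nhds.2 fun α => by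
    have hα := cutoffTendsto_bracket_mul_schwartzMultiDeriv γ α.1 χ hχ hχc f
    rwa [hχ₀, Complex.ofReal_one, one_smul] at hα
  exact ((PiLp.continuous_toLp 1 _).tendsto _).comp hpi

theorem schwartzJet_mem_sobolev (s : ℕ) (γ : ℝ) (f : 𝓢(Plane, ℂ)) :
    schwartzJet s γ f ∈ Sobolev s γ := by
  let χ : ContDiffBump (0 : Plane) := ⟨1, 2, one_pos, one_lt_two⟩
  have hχ₀ : χ 0 = 1 := χ.one_of_mem_closedBall (by simp [χ])
  refine mem_closure_of_tendsto (b := 𝓝[≠] (0 : ℝ))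
    ((tendsto_schwartzJet_dilate χ.contDiff χ.hasCompactSupport hχ₀ s γ f).mono_left
      nhdsWithin_le_nhds) (eventually_mem_nhdsWithin.mono fun ε hε => ?_)
  exact ⟨_, isTest_schwartzMul (contDiff_dilate χ.contDiff ε)
    (hasCompactSupport_dilate χ.hasCompactSupport hε) f, isWeightedJet_schwartzJet s γ _⟩

end Cutoff

/-! ### The operator `Δ - 1` on weighted Sobolev spaces -/

section Extension

/-- Schwartz functions as elements of `H^s_γ`. -/
def schwartzToSobolev (s : ℕ) (γ : ℝ) : 𝓢(Plane, ℂ) →ₗ[ℂ] Sobolev s γ :=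
  (schwartzJet s γ).codRestrict (Sobolev s γ) (schwartzJet_mem_sobolev s γ)

theorem IsTest.exists_schwartz {E : Type*} [NormedAddCommGroup E] [NormedSpace ℝ E] {φ : E → ℂ}
    (hφ : IsTest φ) : ∃ f : 𝓢(E, ℂ), ⇑f = φ :=
  ⟨hφ.2.toSchwartzMap hφ.1, rfl⟩

theorem denseRange_schwartzToSobolev (s : ℕ) (γ : ℝ) : DenseRange (schwartzToSobolev s γ) := by
  intro u
  rw [closure_subtype]
  refine closure_mono ?_ u.2
  rintro v ⟨φ, hφ, hv⟩
  obtain ⟨f, rfl⟩ := hφ.exists_schwartz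
  refine ⟨_, ⟨f, rfl⟩, ?_⟩
  change schwartzJet s γ f = v
  ext1 α
  exact Lp.ext ((isWeightedJet_schwartzJet s γ f α).trans (hv α).symm)

instance (s : ℕ) (γ : ℝ) : CompleteSpace (Sobolev s γ) :=
  (testJets s γ).isClosed_topologicalClosure.completeSpace_coe

/-- The operator `Δ - 1` from `H^{s+2}_γ` to `H^s_γ`: the continuous extension of `Δ - 1` on
Schwartz functions. -/
def sobolevHelmholtz (s : ℕ) (γ : ℝ) : Sobolev (s + 2) γ ≃L[ℂ] Sobolev s γ :=
  helmholtzEquiv.extend (schwartzToSobolev (s + 2) γ) (schwartzToSobolev s γ)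
    (denseRange_schwartzToSobolev _ _) (exists_norm_schwartzJet_helmholtz_le s γ)
    (denseRange_schwartzToSobolev _ _) <| by
      obtain ⟨C, hC⟩ := exists_norm_schwartzJet_le_helmholtz s γ
      refine ⟨C, fun f => ?_⟩
      have h := hC (helmholtzEquiv.symm f)
      rwa [← helmholtzEquiv_apply, LinearEquiv.apply_symm_apply] at h

theorem sobolevHelmholtz_schwartzToSobolev (s : ℕ) (γ : ℝ) (f : 𝓢(Plane, ℂ)) :
    sobolevHelmholtz s γ (schwartzToSobolev (s + 2) γ f) = schwartzToSobolev s γ (helmholtz f) :=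
  LinearEquiv.extend_eq ..

theorem bracket_rpow_neg_mul (γ : ℝ) (x : Plane) :
    ((bracket x ^ (-γ) : ℝ) : ℂ) * ((bracket x ^ γ : ℝ) : ℂ) = 1 := by
  rw [← Complex.ofReal_mul, ← Real.rpow_add (bracket_pos x), neg_add_cancel, Real.rpow_zero,
    Complex.ofReal_one]

theorem toFun_schwartzToSobolev (s : ℕ) (γ : ℝ) (f : 𝓢(Plane, ℂ)) :
    toFun (schwartzToSobolev s γ f) =ᵐ[volume] f := by
  filter_upwards [isWeightedJet_schwartzJet s γ f ⟨(0, 0), Nat.zero_le s⟩] with x hx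
  change _ * (schwartzJet s γ f) _ x = _
  rw [hx, ← mul_assoc, bracket_rpow_neg_mul, one_mul]
  rfl

/-- The bilinear pairing `u ↦ ∫ u f` of `H^s_γ` with a Schwartz function. -/
def pairingCLM {s : ℕ} {γ : ℝ} (f : 𝓢(Plane, ℂ)) : Sobolev s γ →L[ℂ] ℂ :=
  (innerSL ℂ (star (schwartzToL2 (schwartzMul (fun x => bracket x ^ (-γ)) f)))) ∘L
    (PiLp.proj 1 (fun _ : MultiIndex s => Lp ℂ 2 (volume : Measure Plane))
      ⟨(0, 0), Nat.zero_le s⟩) ∘L (Sobolev s γ).subtypeL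

theorem pairingCLM_apply {s : ℕ} {γ : ℝ} (f : 𝓢(Plane, ℂ)) (u : Sobolev s γ) :
    pairingCLM f u = ∫ x, toFun u x * f x := by
  change inner ℂ (star (schwartzToL2 _)) ((u : JetSpace s) _) = _
  rw [L2.inner_def]
  refine integral_congr_ae ?_
  filter_upwards [Lp.coeFn_star (schwartzToL2 (schwartzMul (fun x => bracket x ^ (-γ)) f)),
    coeFn_toLp (schwartzMul (fun x => bracket x ^ (-γ)) f) 2 volume] with x hstar hmul
  rw [hstar, Pi.star_apply, toLpCLM_apply, hmul,
    schwartzMul_apply (hasTemperateGrowth_bracket_rpow (-γ)), toFun, RCLike.inner_apply,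
    starRingEnd_apply, star_star, Complex.real_smul]
  ring

theorem integral_helmholtz_mul {E : Type*} [NormedAddCommGroup E] [InnerProductSpace ℝ E]
    [FiniteDimensional ℝ E] [MeasurableSpace E] [BorelSpace E] (f g : 𝓢(E, ℂ)) :
    ∫ x, helmholtz f x * g x = ∫ x, f x * helmholtz g x := by
  have hint : ∀ f g : 𝓢(E, ℂ), Integrable fun x => f x * g x := fun f g =>
    (pairing (ContinuousLinearMap.mul ℂ ℂ) f g).integrable
  simp only [helmholtz_apply, sub_apply, sub_mul, mul_sub]
  rw [integral_sub (hint _ g) (hint f g), integral_sub (hint f _) (hint f g),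
    integral_mul_laplacian_right_eq_left (μ := volume) f g]

theorem integral_sobolevHelmholtz_mul {s : ℕ} {γ : ℝ} (u : Sobolev (s + 2) γ)
    (f : 𝓢(Plane, ℂ)) :
    ∫ x, toFun (sobolevHelmholtz s γ u) x * f x = ∫ x, toFun u x * helmholtz f x := by
  simp only [← pairingCLM_apply]
  refine (denseRange_schwartzToSobolev (s + 2) γ).induction_on u
    (isClosed_eq (by fun_prop) (by fun_prop)) fun g => ?_
  rw [sobolevHelmholtz_schwartzToSobolev, pairingCLM_apply, pairingCLM_apply]
  calc _ = ∫ x, helmholtz g x * f x :=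
        integral_congr_ae ((toFun_schwartzToSobolev s γ _).mul .rfl)
    _ = ∫ x, g x * helmholtz f x := integral_helmholtz_mul g f
    _ = _ := integral_congr_ae ((toFun_schwartzToSobolev (s + 2) γ g).symm.mul .rfl)

theorem laplacianSubId_sobolevHelmholtz {s : ℕ} {γ : ℝ} (u : Sobolev (s + 2) γ) :
    LaplacianSubId (toFun u) (toFun (sobolevHelmholtz s γ u)) := by
  intro φ hφ
  obtain ⟨f, rfl⟩ := hφ.exists_schwartz
  simpa only [helmholtz_apply, sub_apply, laplacian_apply] using integral_sobolevHelmholtz_mul u f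

end Extension

/-! ### Rotations and angular modes -/

section Rotation

section Isometry

variable {E F : Type*} [NormedAddCommGroup E] [InnerProductSpace ℝ E] [NormedAddCommGroup F]
  [InnerProductSpace ℂ F]

/-- Composition of Schwartz functions with a linear isometry. -/
def schwartzComp (L : E ≃ₗᵢ[ℝ] E) : 𝓢(E, F) →L[ℂ] 𝓢(E, F) :=
  compCLMOfContinuousLinearEquiv ℂ L.toContinuousLinearEquiv

theorem schwartzComp_apply (L : E ≃ₗᵢ[ℝ] E) (f : 𝓢(E, F)) (x : E) :
    schwartzComp L f x = f (L x) :=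
  rfl

variable [FiniteDimensional ℝ E]

theorem helmholtz_schwartzComp (L : E ≃ₗᵢ[ℝ] E) (f : 𝓢(E, F)) :
    helmholtz (schwartzComp L f) = schwartzComp L (helmholtz f) := by
  let b := stdOrthonormalBasis ℝ E
  rw [helmholtz_eq_sum b, helmholtz_eq_sum (b.map L), map_sub, map_sum]
  simp only [schwartzComp, lineDerivOp_compCLMOfContinuousLinearEquiv, b.map_apply]
  rfl

variable [MeasurableSpace E] [BorelSpace E]

theorem integral_mul_schwartzComp_symm (L : E ≃ₗᵢ[ℝ] E) (g : E → ℂ) (f : 𝓢(E, ℂ)) :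
    ∫ x, g x * schwartzComp L.symm f x = ∫ x, g (L x) * f x := by
  rw [← L.measurePreserving.integral_comp L.toHomeomorph.measurableEmbedding]
  simp only [schwartzComp_apply, L.symm_apply_apply]

theorem locallyIntegrable_comp_isometry (L : E ≃ₗᵢ[ℝ] E) {g : E → ℂ} (hg : LocallyIntegrable g) :
    LocallyIntegrable fun x => g (L x) := by
  refine (locallyIntegrable_map_homeomorph L.toHomeomorph).1 ?_
  exact L.measurePreserving.map_eq.symm ▸ hg

theorem ae_eq_of_integral_mul_isTest_eq {f g : E → ℂ} (hf : LocallyIntegrable f)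
    (hg : LocallyIntegrable g) (h : ∀ φ, IsTest φ → ∫ x, f x * φ x = ∫ x, g x * φ x) :
    f =ᵐ[volume] g := by
  refine ae_eq_of_integral_contDiff_smul_eq hf hg fun φ hφ hφc => ?_
  simpa only [Complex.real_smul, mul_comm] using h (fun x => (φ x : ℂ))
    ⟨Complex.ofRealCLM.contDiff.comp hφ, hφc.comp_left (g := ((↑) : ℝ → ℂ)) Complex.ofReal_zero⟩

end Isometry

/-- The identification of the plane with `ℂ`. -/
def toComplex : Plane ≃ₗᵢ[ℝ] ℂ :=
  Complex.orthonormalBasisOneI.repr.symm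

theorem toComplex_apply (x : Plane) : toComplex x = ⟨x 0, x 1⟩ := by
  change Complex.orthonormalBasisOneI.repr.symm x = _
  rw [Complex.orthonormalBasisOneI_repr_symm_apply, Complex.mk_eq_add_mul_I]

/-- The rotation of the plane by `a`. -/
def planeRotation (a : Circle) : Plane ≃ₗᵢ[ℝ] Plane :=
  (toComplex.trans (rotation a)).trans toComplex.symm

theorem toComplex_planeRotation (a : Circle) (x : Plane) :
    toComplex (planeRotation a x) = a * toComplex x :=
  toComplex.apply_symm_apply _

theorem planeRotation_mul (a b : Circle) (x : Plane) :
    planeRotation (a * b) x = planeRotation a (planeRotation b x) :=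
  toComplex.injective (by simp only [toComplex_planeRotation, Circle.coe_mul, mul_assoc])

theorem continuous_planeRotation : Continuous fun z : Plane × Circle => planeRotation z.2 z.1 := by
  change Continuous fun z : Plane × Circle => toComplex.symm ((z.2 : ℂ) * toComplex z.1)
  fun_prop

/-- The unit complex number with the argument of `x`. -/
def phase (x : Plane) : Circle := Circle.exp (Complex.arg (toComplex x))

theorem angular_eq_phase_pow (n : ℕ) (x : Plane) : angular n x = (phase x : ℂ) ^ n := by
  rw [angular, phase, Circle.coe_exp, ← Complex.exp_nat_mul, toComplex_apply, mul_assoc]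

theorem norm_mul_phase (x : Plane) : (‖x‖ : ℂ) * phase x = toComplex x := by
  rw [phase, Circle.coe_exp, ← toComplex.norm_map x]
  exact Complex.norm_mul_exp_arg_mul_I _

theorem planeRotation_phase (x : Plane) :
    planeRotation (phase x) (toComplex.symm (‖x‖ : ℂ)) = x :=
  toComplex.injective (by
    rw [toComplex_planeRotation, LinearIsometryEquiv.apply_symm_apply, mul_comm, norm_mul_phase])

theorem phase_planeRotation (a : Circle) {x : Plane} (hx : x ≠ 0) :
    (phase (planeRotation a x) : ℂ) = a * phase x := by
  have h := norm_mul_phase (planeRotation a x)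
  rw [toComplex_planeRotation, LinearIsometryEquiv.norm_map, ← norm_mul_phase x,
    mul_left_comm] at h
  exact mul_left_cancel₀ (Complex.ofReal_ne_zero.2 (norm_ne_zero_iff.2 hx)) h

theorem angular_planeRotation (n : ℕ) (a : Circle) {x : Plane} (hx : x ≠ 0) :
    angular n (planeRotation a x) = (a : ℂ) ^ n * angular n x := by
  rw [angular_eq_phase_pow, angular_eq_phase_pow, phase_planeRotation a hx, mul_pow]

instance : MeasurableSpace Circle := borel Circle

instance : BorelSpace Circle := ⟨rfl⟩

/-- The component of angular frequency `n` of a function on the plane: the average of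
`a⁻ⁿ g(a·)` over the rotations `a`. -/
def angularComponent (n : ℕ) (g : Plane → ℂ) (x : Plane) : ℂ :=
  ∫ a : Circle, ((a : ℂ) ^ n)⁻¹ * g (planeRotation a x) ∂Measure.haarMeasure ⊤

theorem angularComponent_planeRotation (n : ℕ) (g : Plane → ℂ) (b : Circle) (x : Plane) :
    angularComponent n g (planeRotation b x) = (b : ℂ) ^ n * angularComponent n g x := by
  have hshift (a : Circle) :
      ((a : ℂ) ^ n)⁻¹ * g (planeRotation a (planeRotation b x)) =
        (b : ℂ) ^ n * ((((a * b : Circle) : ℂ) ^ n)⁻¹ * g (planeRotation (a * b) x)) := by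
    rw [planeRotation_mul, Circle.coe_mul, mul_comm (a : ℂ), mul_pow, mul_inv, mul_assoc,
      mul_inv_cancel_left₀ (pow_ne_zero n (Circle.coe_ne_zero b))]
  simp only [angularComponent, hshift, integral_const_mul]
  rw [integral_mul_right_eq_self fun a : Circle => ((a : ℂ) ^ n)⁻¹ * g (planeRotation a x)]

theorem angularComponent_eq_mul_angular (n : ℕ) (g : Plane → ℂ) (x : Plane) :
    angularComponent n g x = angularComponent n g (toComplex.symm (‖x‖ : ℂ)) * angular n x := by
  conv_lhs => rw [← planeRotation_phase x]
  rw [angularComponent_planeRotation, angular_eq_phase_pow, mul_comm]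

theorem angularComponent_ae_eq {g : Plane → ℂ} (hg : Measurable g) {n : ℕ}
    (h : ∀ a : Circle, ∀ᵐ x, g (planeRotation a x) = (a : ℂ) ^ n * g x) :
    angularComponent n g =ᵐ[volume] g := by
  let μ := Measure.haarMeasure (⊤ : TopologicalSpace.PositiveCompacts Circle)
  have : IsProbabilityMeasure μ := ⟨Measure.haarMeasure_self⟩
  have hmeas : MeasurableSet {z : Plane × Circle |
      g (planeRotation z.2 z.1) = (z.2 : ℂ) ^ n * g z.1} :=
    measurableSet_eq_fun (hg.comp continuous_planeRotation.measurable)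
      (.mul (by fun_prop) (hg.comp measurable_fst))
  have hswap : ∀ᵐ x : Plane, ∀ᵐ a ∂μ, g (planeRotation a x) = (a : ℂ) ^ n * g x :=
    (Measure.ae_ae_comm hmeas).2 (.of_forall h)
  filter_upwards [hswap] with x hx
  calc angularComponent n g x = ∫ _, g x ∂μ := integral_congr_ae <| by
        filter_upwards [hx] with a ha
        rw [ha, inv_mul_cancel_left₀ (pow_ne_zero n (Circle.coe_ne_zero a))]
    _ = g x := by rw [integral_const, probReal_univ, one_smul]

theorem measurable_toFun {s : ℕ} {γ : ℝ} (u : Sobolev s γ) : Measurable (toFun u) :=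
  (Complex.measurable_ofReal.comp
    (hasTemperateGrowth_bracket_rpow (-γ)).1.continuous.measurable).mul
      (Lp.stronglyMeasurable _).measurable

theorem locallyIntegrable_toFun {s : ℕ} {γ : ℝ} (u : Sobolev s γ) :
    LocallyIntegrable (toFun u) := by
  have hLp : LocallyIntegrable ((u : JetSpace s) ⟨(0, 0), Nat.zero_le s⟩ : Plane → ℂ) :=
    (Lp.memLp _).locallyIntegrable one_le_two
  have hcont : Continuous fun x : Plane => ((bracket x ^ (-γ) : ℝ) : ℂ) :=
    Complex.continuous_ofReal.comp (hasTemperateGrowth_bracket_rpow (-γ)).1.continuous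
  rw [← locallyIntegrableOn_univ] at hLp ⊢
  exact hLp.continuousOn_mul hcont.continuousOn isOpen_univ.isLocallyClosed

theorem mem_modeSpace_iff_ae_rotation {n s : ℕ} {γ : ℝ} (u : Sobolev s γ) :
    u ∈ modeSpace n s γ ↔
      ∀ a : Circle, ∀ᵐ x, toFun u (planeRotation a x) = (a : ℂ) ^ n * toFun u x := by
  refine ⟨fun ⟨p, hp⟩ a => ?_, fun h => ?_⟩
  · filter_upwards [hp, (planeRotation a).measurePreserving.quasiMeasurePreserving.ae hp,
      Measure.ae_ne volume 0] with x hx hax hx₀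
    rw [hx, hax, angular_planeRotation n a hx₀, LinearIsometryEquiv.norm_map, mul_left_comm]
  · refine ⟨fun r => angularComponent n (toFun u) (toComplex.symm (r : ℂ)), ?_⟩
    exact (angularComponent_ae_eq (measurable_toFun u) h).symm.trans
      (.of_forall (angularComponent_eq_mul_angular n _))

theorem mem_modeSpace_iff_integral_rotation {n s : ℕ} {γ : ℝ} (u : Sobolev s γ) :
    u ∈ modeSpace n s γ ↔ ∀ (a : Circle) (f : 𝓢(Plane, ℂ)),
      ∫ x, toFun u x * schwartzComp (planeRotation a).symm f x =
        (a : ℂ) ^ n * ∫ x, toFun u x * f x := by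
  simp only [mem_modeSpace_iff_ae_rotation, integral_mul_schwartzComp_symm]
  refine forall_congr' fun a => ⟨fun h f => ?_, fun h => ?_⟩
  · rw [← integral_const_mul]
    refine integral_congr_ae ?_
    filter_upwards [h] with x hx
    rw [hx, mul_assoc]
  · refine ae_eq_of_integral_mul_isTest_eq
      (locallyIntegrable_comp_isometry _ (locallyIntegrable_toFun u))
      ((locallyIntegrable_toFun u).smul ((a : ℂ) ^ n)) fun φ hφ => ?_
    obtain ⟨f, rfl⟩ := hφ.exists_schwartz
    simpa only [Pi.smul_apply, smul_eq_mul, mul_assoc, integral_const_mul] using h f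

theorem sobolevHelmholtz_mem_modeSpace_iff {n s : ℕ} {γ : ℝ} (u : Sobolev (s + 2) γ) :
    sobolevHelmholtz s γ u ∈ modeSpace n s γ ↔ u ∈ modeSpace n (s + 2) γ := by
  simp only [mem_modeSpace_iff_integral_rotation, integral_sobolevHelmholtz_mul,
    helmholtz_schwartzComp]
  exact forall_congr' fun a => (helmholtzEquiv.surjective.forall (p := fun f =>
    ∫ x, toFun u x * schwartzComp (planeRotation a).symm f x =
      (a : ℂ) ^ n * ∫ x, toFun u x * f x)).symm

/-- The operator `Δ - 1` on the functions of the form `p(r) e^{inθ}`. -/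
def modeHelmholtz (n s : ℕ) (γ : ℝ) : modeSpace n (s + 2) γ ≃L[ℂ] modeSpace n s γ :=
  (sobolevHelmholtz s γ).ofSubmodules _ _ <| by
    ext v
    obtain ⟨u, rfl⟩ := (sobolevHelmholtz s γ).surjective v
    exact (sobolevHelmholtz s γ).injective.mem_set_image.trans
      (sobolevHelmholtz_mem_modeSpace_iff u).symm

end Rotation

/-! ### The radial equation -/

section Radial

theorem natCast_mul_pow_pred_mul {R : Type*} [Semiring R] (n : ℕ) (a : R) :
    n * a ^ (n - 1) * a = n * a ^ n := by
  rcases n with _ | n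
  · simp
  · rw [Nat.add_sub_cancel, mul_assoc, ← pow_succ]

section Laplacian

variable {E : Type*} [NormedAddCommGroup E] [InnerProductSpace ℝ E] {k : ℝ → ℂ} {h : E → ℂ}

theorem hasFDerivAt_comp_norm_sq (hk : Differentiable ℝ k) (x : E) :
    HasFDerivAt (fun y : E => k (‖y‖ ^ 2))
      (ContinuousLinearMap.toSpanSingleton ℝ (deriv k (‖x‖ ^ 2)) ∘L (2 • innerSL ℝ x)) x :=
  (hk _).hasDerivAt.hasFDerivAt.comp x (hasStrictFDerivAt_norm_sq x).hasFDerivAt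

theorem fderiv_comp_norm_sq_mul (hk : Differentiable ℝ k) (hh : Differentiable ℝ h) (x v : E) :
    fderiv ℝ (fun y => k (‖y‖ ^ 2) * h y) x v =
      2 * inner ℝ x v * (deriv k (‖x‖ ^ 2) * h x) + k (‖x‖ ^ 2) * fderiv ℝ h x v := by
  rw [((hasFDerivAt_comp_norm_sq hk x).fun_mul (hh x).hasFDerivAt).fderiv]
  simp only [ContinuousLinearMap.comp_smul, add_apply, smul_apply, smul_eq_mul,
    ContinuousLinearMap.comp_apply, coe_innerSL_apply, ContinuousLinearMap.toSpanSingleton_apply,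
    Complex.real_smul, nsmul_eq_mul, Nat.cast_ofNat]
  ring

theorem fderiv_fderiv_comp_norm_sq_mul (hk : ContDiff ℝ 2 k) (hh : ContDiff ℝ 2 h) (x v : E) :
    fderiv ℝ (fun y => fderiv ℝ (fun z => k (‖z‖ ^ 2) * h z) y v) x v =
      4 * (inner ℝ x v : ℂ) ^ 2 * (deriv (deriv k) (‖x‖ ^ 2) * h x) +
        2 * (‖v‖ : ℂ) ^ 2 * (deriv k (‖x‖ ^ 2) * h x) +
        4 * deriv k (‖x‖ ^ 2) * (inner ℝ x v * fderiv ℝ h x v) +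
        k (‖x‖ ^ 2) * fderiv ℝ (fun y => fderiv ℝ h y v) x v := by
  have hk₁ : Differentiable ℝ k := hk.differentiable two_ne_zero
  have hh₁ : Differentiable ℝ h := hh.differentiable two_ne_zero
  have hk₂ : Differentiable ℝ (deriv k) := hk.differentiable_deriv_two
  have hh₂ : Differentiable ℝ fun y => fderiv ℝ h y v :=
    ((hh.fderiv_right one_add_one_eq_two.le).differentiable one_ne_zero).clm_apply
      (differentiable_const v)
  have hinner : HasFDerivAt (fun y => 2 * (inner ℝ y v : ℂ))
      ((2 : ℂ) • Complex.ofRealCLM ∘L innerSL ℝ v) x := by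
    simp only [real_inner_comm v]
    exact (Complex.ofRealCLM ∘L innerSL ℝ v).hasFDerivAt.const_mul 2
  have hprod {l : ℝ → ℂ} {f : E → ℂ} (hl : Differentiable ℝ l) (hf : Differentiable ℝ f) :
      DifferentiableAt ℝ (fun y => l (‖y‖ ^ 2) * f y) x :=
    (hasFDerivAt_comp_norm_sq hl x).differentiableAt.mul (hf x)
  simp only [fderiv_comp_norm_sq_mul hk₁ hh₁]
  rw [fderiv_fun_add (hinner.differentiableAt.fun_mul (hprod hk₂ hh₁)) (hprod hk₁ hh₂), add_apply,
    (hinner.fun_mul (hprod hk₂ hh₁).hasFDerivAt).fderiv, fderiv_comp_norm_sq_mul hk₁ hh₂]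
  simp only [add_apply, smul_apply, fderiv_comp_norm_sq_mul hk₂ hh₁, smul_eq_mul,
    ContinuousLinearMap.comp_apply, coe_innerSL_apply, inner_self_eq_norm_sq_to_K,
    Real.ringHom_apply, Complex.ofRealCLM_apply, Complex.ofReal_pow]
  ring

variable [FiniteDimensional ℝ E] {ι : Type*} [Fintype ι]

theorem laplacian_eq_sum_fderiv_fderiv {F : Type*} [NormedAddCommGroup F] [NormedSpace ℝ F]
    (b : OrthonormalBasis ι ℝ E) {f : E → F} (hf : ContDiff ℝ 2 f) (x : E) :
    Δ f x = ∑ i, fderiv ℝ (fun y => fderiv ℝ f y (b i)) x (b i) := by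
  have hf' : Differentiable ℝ (fderiv ℝ f) :=
    (hf.fderiv_right one_add_one_eq_two.le).differentiable one_ne_zero
  rw [InnerProductSpace.laplacian_eq_iteratedFDeriv_orthonormalBasis f b]
  refine Finset.sum_congr rfl fun i _ => ?_
  rw [iteratedFDeriv_two_apply, fderiv_clm_apply (hf' x) (differentiableAt_const _)]
  simp

theorem laplacian_comp_norm_sq_mul (hk : ContDiff ℝ 2 k) (hh : ContDiff ℝ 2 h) (x : E) :
    Δ (fun y => k (‖y‖ ^ 2) * h y) x =
      (4 * ‖x‖ ^ 2 * deriv (deriv k) (‖x‖ ^ 2) +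
          2 * Module.finrank ℝ E * deriv k (‖x‖ ^ 2)) * h x +
        4 * deriv k (‖x‖ ^ 2) * fderiv ℝ h x x + k (‖x‖ ^ 2) * Δ h x := by
  let b := stdOrthonormalBasis ℝ E
  have hnorm : ∑ i, (inner ℝ x (b i) : ℂ) ^ 2 = (‖x‖ : ℂ) ^ 2 := by
    exact_mod_cast b.sum_sq_inner_left x
  have hfderiv : ∑ i, (inner ℝ x (b i) : ℂ) * fderiv ℝ h x (b i) = fderiv ℝ h x x := by
    simpa only [map_sum, map_smul, Complex.real_smul, real_inner_comm] using
      congrArg (fderiv ℝ h x) (b.sum_repr' x)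
  rw [laplacian_eq_sum_fderiv_fderiv b ((hk.fun_comp (contDiff_norm_sq ℝ)).mul hh),
    laplacian_eq_sum_fderiv_fderiv b hh]
  simp only [fderiv_fderiv_comp_norm_sq_mul hk hh, b.norm_eq_one, Finset.sum_add_distrib,
    ← Finset.sum_mul, ← Finset.mul_sum, hnorm, hfderiv,
    Finset.sum_const, Finset.card_univ, Fintype.card_fin, nsmul_eq_mul, Complex.ofReal_one,
    one_pow, mul_one]
  ring

theorem fderiv_clm_pow_apply {E : Type*} [NormedAddCommGroup E] [NormedSpace ℝ E] (L : E →L[ℝ] ℂ)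
    (n : ℕ) (x v : E) : fderiv ℝ (fun y => L y ^ n) x v = n * L x ^ (n - 1) * L v := by
  rw [((L.hasFDerivAt (x := x)).pow n).fderiv]
  simp

theorem laplacian_comp_norm_sq_mul_clm_pow (b : OrthonormalBasis ι ℝ E) {L : E →L[ℝ] ℂ}
    (hL : ∑ i, L (b i) ^ 2 = 0) (hk : ContDiff ℝ 2 k) (n : ℕ) (x : E) :
    Δ (fun y => k (‖y‖ ^ 2) * L y ^ n) x =
      (4 * ‖x‖ ^ 2 * deriv (deriv k) (‖x‖ ^ 2) +
        (2 * Module.finrank ℝ E + 4 * n) * deriv k (‖x‖ ^ 2)) * L x ^ n := by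
  have hpow : ContDiff ℝ 2 fun y => L y ^ n := L.contDiff.pow n
  -- `Lⁿ` is harmonic and homogeneous of degree `n`.
  have heuler : fderiv ℝ (fun y => L y ^ n) x x = n * L x ^ n := by
    rw [fderiv_clm_pow_apply, natCast_mul_pow_pred_mul]
  have hharmonic : Δ (fun y => L y ^ n) x = 0 := by
    rw [laplacian_eq_sum_fderiv_fderiv b hpow]
    have hderiv (v : E) : fderiv ℝ (fun y => n * L y ^ (n - 1) * L v) x v =
        n * ((n - 1 : ℕ) * L x ^ (n - 1 - 1)) * L v ^ 2 := by
      rw [fderiv_mul_const (by fun_prop), fderiv_const_mul (by fun_prop)]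
      simp only [smul_apply, fderiv_clm_pow_apply, smul_eq_mul]
      ring
    simp only [fderiv_clm_pow_apply, hderiv, ← Finset.mul_sum, hL, mul_zero]
  rw [laplacian_comp_norm_sq_mul hk hpow, heuler, hharmonic]
  ring

end Laplacian

/-- The complex conjugate of the coordinate `x₁ + i x₂`, a linear function with harmonic powers. -/
def conjCoord : Plane →L[ℝ] ℂ :=
  (Complex.conjCLE : ℂ →L[ℝ] ℂ) ∘L (toComplex : Plane →L[ℝ] ℂ)

theorem sum_conjCoord_sq : ∑ i, conjCoord (EuclideanSpace.basisFun (Fin 2) ℝ i) ^ 2 = 0 := by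
  simp [conjCoord, toComplex_apply, Fin.sum_univ_two, Complex.ext_iff, pow_two]

theorem angular_mul_conjCoord_pow (n : ℕ) (x : Plane) :
    angular n x * conjCoord x ^ n = (‖x‖ : ℂ) ^ n := by
  have hconj : conjCoord x = ‖x‖ * (starRingEnd ℂ) (phase x : ℂ) := by
    change (starRingEnd ℂ) (toComplex x) = _
    rw [← norm_mul_phase x, map_mul, Complex.conj_ofReal]
  have hphase : (phase x : ℂ) * (starRingEnd ℂ) (phase x : ℂ) = 1 := by
    rw [Complex.mul_conj, Circle.normSq_coe, Complex.ofReal_one]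
  rw [angular_eq_phase_pow, hconj, ← mul_pow, mul_left_comm, hphase, mul_one]

theorem hasDerivAt_comp_sq_mul_pow {k : ℝ → ℂ} (hk : Differentiable ℝ k) (n : ℕ) {r : ℝ}
    (hr : r ≠ 0) :
    HasDerivAt (fun r : ℝ => k (r ^ 2) * (r : ℂ) ^ n)
      (2 * r * (deriv k (r ^ 2) * r ^ n) + n / r * (k (r ^ 2) * r ^ n)) r := by
  have hcomp : HasDerivAt (fun r : ℝ => k (r ^ 2)) (2 * r * deriv k (r ^ 2)) r := by
    simpa [Function.comp_def] using (hk (r ^ 2)).hasDerivAt.scomp r (hasDerivAt_pow 2 r)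
  have hpow : HasDerivAt (fun r : ℝ => (r : ℂ) ^ n) (n / r * (r : ℂ) ^ n) r := by
    have hr₀ : (r : ℂ) ≠ 0 := Complex.ofReal_ne_zero.2 hr
    refine ((hasDerivAt_id r).ofReal_comp.fun_pow n).congr_deriv ?_
    rw [div_mul_eq_mul_div, eq_div_iff hr₀, ← natCast_mul_pow_pred_mul]
    simp
  exact (hcomp.fun_mul hpow).congr_deriv (by ring)

theorem radialLaplacian_comp_sq_mul_pow {k : ℝ → ℂ} (hk : ContDiff ℝ 2 k) (n : ℕ) {ψ : ℝ → ℂ}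
    (hψ : ∀ r, 0 < r → ψ r = k (r ^ 2) * (r : ℂ) ^ n) {r : ℝ} (hr : 0 < r) :
    deriv (deriv ψ) r + deriv ψ r / r - n ^ 2 / r ^ 2 * ψ r =
      (4 * r ^ 2 * deriv (deriv k) (r ^ 2) + (4 + 4 * n) * deriv k (r ^ 2)) * r ^ n := by
  have hk₁ : Differentiable ℝ k := hk.differentiable two_ne_zero
  have hk₂ : Differentiable ℝ (deriv k) := hk.differentiable_deriv_two
  have hψ' {t : ℝ} (ht : 0 < t) : deriv ψ t =
      2 * t * (deriv k (t ^ 2) * t ^ n) + n / t * (k (t ^ 2) * t ^ n) := by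
    have heq : ψ =ᶠ[𝓝 t] fun r => k (r ^ 2) * (r : ℂ) ^ n :=
      (eventually_gt_nhds ht).mono hψ
    rw [heq.deriv_eq, (hasDerivAt_comp_sq_mul_pow hk₁ n ht.ne').deriv]
  have heq : deriv ψ =ᶠ[𝓝 r] fun t =>
      2 * t * (deriv k (t ^ 2) * t ^ n) + n / t * (k (t ^ 2) * t ^ n) :=
    (eventually_gt_nhds hr).mono fun _ => hψ'
  have hr₀ : (r : ℂ) ≠ 0 := Complex.ofReal_ne_zero.2 hr.ne'
  have hid : HasDerivAt (fun t : ℝ => (t : ℂ)) 1 r := (hasDerivAt_id r).ofReal_comp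
  have hψ'' := ((hid.const_mul 2).fun_mul (hasDerivAt_comp_sq_mul_pow hk₂ n hr.ne')).fun_add
    (((hasDerivAt_const r (n : ℂ)).fun_div hid hr₀).fun_mul
      (hasDerivAt_comp_sq_mul_pow hk₁ n hr.ne'))
  rw [heq.deriv_eq, hψ''.deriv, hψ' hr, hψ r hr]
  field_simp
  ring

theorem integral_comp_norm (F : ℝ → ℂ) :
    ∫ x : Plane, F ‖x‖ = (2 * Real.pi) • ∫ r in Ioi (0 : ℝ), F r * r := by
  rw [integral_fun_norm_addHaar, finrank_euclideanSpace_fin]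
  simp [Measure.real, mul_smul, Real.pi_nonneg, mul_comm (F _)]

/-- The function `k` with `ψ(r) = k(r²) rⁿ` for `r > 0`. It is smooth up to `0` if `ψ` is a test
function on `(0, ∞)`. -/
def radialQuotient (n : ℕ) (ψ : ℝ → ℂ) (t : ℝ) : ℂ := (Real.sqrt t ^ n)⁻¹ • ψ (Real.sqrt t)

theorem radialQuotient_sq_mul_pow (n : ℕ) (ψ : ℝ → ℂ) {r : ℝ} (hr : 0 < r) :
    radialQuotient n ψ (r ^ 2) * (r : ℂ) ^ n = ψ r := by
  rw [radialQuotient, Real.sqrt_sq hr.le, Complex.real_smul, mul_right_comm, Complex.ofReal_inv,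
    Complex.ofReal_pow, inv_mul_cancel₀ (pow_ne_zero n (Complex.ofReal_ne_zero.2 hr.ne')), one_mul]

theorem contDiff_radialQuotient (n : ℕ) {ψ : ℝ → ℂ} {m : ℕ∞} (hψ : ContDiff ℝ m ψ)
    (hsupp : tsupport ψ ⊆ Ioi 0) : ContDiff ℝ m (radialQuotient n ψ) := by
  refine contDiff_iff_contDiffAt.2 fun t => ?_
  rcases lt_or_ge 0 t with ht | ht
  · have hsqrt : ContDiffAt ℝ m Real.sqrt t := Real.contDiffAt_sqrt ht.ne'
    exact ((hsqrt.pow n).inv (pow_ne_zero _ (Real.sqrt_pos.2 ht).ne')).smul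
      (hψ.contDiffAt.comp t hsqrt)
  · have hψ₀ : ∀ᶠ r in 𝓝 (Real.sqrt t), ψ r = 0 := by
      rw [Real.sqrt_eq_zero_of_nonpos ht]
      exact notMem_tsupport_iff_eventuallyEq.1 fun h => lt_irrefl (0 : ℝ) (hsupp h)
    refine (contDiffAt_const (c := (0 : ℂ))).congr_of_eventuallyEq ?_
    filter_upwards [Real.continuous_sqrt.continuousAt.eventually hψ₀] with r hr
    rw [radialQuotient, hr, smul_zero]

/-- The function `ψ(r) e^{-inθ}` on the plane, in the form `k(|x|²) z̄ⁿ` in which it is seen to be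
smooth at the origin. -/
def conjMode (n : ℕ) (ψ : ℝ → ℂ) (x : Plane) : ℂ :=
  radialQuotient n ψ (‖x‖ ^ 2) * conjCoord x ^ n

section ConjMode

variable {n : ℕ} {ψ : ℝ → ℂ} {x : Plane}

theorem angular_mul_conjMode (hx : x ≠ 0) : angular n x * conjMode n ψ x = ψ ‖x‖ := by
  rw [conjMode, mul_left_comm, angular_mul_conjCoord_pow,
    radialQuotient_sq_mul_pow n ψ (norm_pos_iff.2 hx)]

theorem angular_mul_laplacian_conjMode (hψ : ContDiff ℝ 2 ψ) (hsupp : tsupport ψ ⊆ Ioi 0)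
    (hx : x ≠ 0) :
    angular n x * Δ (conjMode n ψ) x =
      deriv (deriv ψ) ‖x‖ + deriv ψ ‖x‖ / ‖x‖ - n ^ 2 / ‖x‖ ^ 2 * ψ ‖x‖ := by
  have hk : ContDiff ℝ 2 (radialQuotient n ψ) := contDiff_radialQuotient n hψ hsupp
  have hlaplacian := laplacian_comp_norm_sq_mul_clm_pow _ sum_conjCoord_sq hk n x
  rw [radialLaplacian_comp_sq_mul_pow hk n
    (fun r hr => (radialQuotient_sq_mul_pow n ψ hr).symm) (norm_pos_iff.2 hx)]
  unfold conjMode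
  rw [hlaplacian, mul_left_comm, angular_mul_conjCoord_pow, finrank_euclideanSpace_fin]
  ring

theorem isTest_conjMode (hψ : IsTest ψ) (hsupp : tsupport ψ ⊆ Ioi 0) :
    IsTest (conjMode n ψ) := by
  refine ⟨((contDiff_radialQuotient n hψ.1 hsupp).fun_comp (contDiff_norm_sq ℝ)).mul
    (conjCoord.contDiff.pow n), ?_⟩
  obtain ⟨R, hR⟩ := hψ.2.isCompact.isBounded.subset_closedBall 0
  refine HasCompactSupport.intro (isCompact_closedBall 0 R) fun x hx => ?_
  have hψx : ψ ‖x‖ = 0 :=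
    image_eq_zero_of_notMem_tsupport fun h => hx (by simpa using hR h)
  rw [conjMode, radialQuotient, Real.sqrt_sq (norm_nonneg x), hψx, smul_zero, zero_mul]

end ConjMode

theorem LaplacianSubId.radial {g h : Plane → ℂ} {n : ℕ} {p q : ℝ → ℂ} (hgh : LaplacianSubId g h)
    (hg : g =ᵐ[volume] fun x => p ‖x‖ * angular n x)
    (hh : h =ᵐ[volume] fun x => q ‖x‖ * angular n x) : RadialLaplacianSubId n p q := by
  intro ψ hψ hsupp
  have hψ₂ : ContDiff ℝ 2 ψ := contDiff_infty.1 hψ.1 2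
  have hpolar : ∫ x : Plane, q ‖x‖ * ψ ‖x‖ = ∫ x : Plane, p ‖x‖ *
      (deriv (deriv ψ) ‖x‖ + deriv ψ ‖x‖ / ‖x‖ - n ^ 2 / ‖x‖ ^ 2 * ψ ‖x‖ - ψ ‖x‖) := by
    convert hgh _ (isTest_conjMode (n := n) hψ hsupp) using 1
    · refine integral_congr_ae ?_
      filter_upwards [hh, Measure.ae_ne volume 0] with x hx hx₀
      rw [hx, mul_assoc, angular_mul_conjMode hx₀]
    · refine integral_congr_ae ?_
      filter_upwards [hg, Measure.ae_ne volume 0] with x hx hx₀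
      rw [hx, mul_assoc, mul_sub (angular n x), angular_mul_laplacian_conjMode hψ₂ hsupp hx₀,
        angular_mul_conjMode hx₀]
  rw [integral_comp_norm fun r => q r * ψ r, integral_comp_norm fun r => p r *
    (deriv (deriv ψ) r + deriv ψ r / r - n ^ 2 / r ^ 2 * ψ r - ψ r)] at hpolar
  exact smul_right_injective ℂ Real.two_pi_pos.ne' hpolar

end Radial

end WeightedSobolev

end

theorem mainTheorem6 (s : ℕ) (hs : 2 ≤ s) (γ : ℝ) :
    (∃ T : WeightedSobolev.Sobolev s γ ≃L[ℂ] WeightedSobolev.Sobolev (s - 2) γ,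
      ∀ u : WeightedSobolev.Sobolev s γ,
        WeightedSobolev.LaplacianSubId (WeightedSobolev.toFun u) (WeightedSobolev.toFun (T u))) ∧
    ∀ n : ℕ,
      ∃ S : WeightedSobolev.modeSpace n s γ ≃L[ℂ] WeightedSobolev.modeSpace n (s - 2) γ,
        ∀ (u : WeightedSobolev.modeSpace n s γ) (p q : ℝ → ℂ),
          WeightedSobolev.IsProfile n p u.1 → WeightedSobolev.IsProfile n q (S u).1 →
            WeightedSobolev.RadialLaplacianSubId n p q := by
  obtain ⟨s, rfl⟩ := Nat.exists_eq_add_of_le' hs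
  exact ⟨⟨WeightedSobolev.sobolevHelmholtz s γ, WeightedSobolev.laplacianSubId_sobolevHelmholtz⟩,
    fun n => ⟨WeightedSobolev.modeHelmholtz n s γ, fun u p q hp hq =>
      (WeightedSobolev.laplacianSubId_sobolevHelmholtz u.1).radial hp hq⟩⟩
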